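/- Let $K$ be a field, $S$ an inverse monoid, $A$ a unital associative $K$-algebra, and let $\theta$ be a unital action of $S$ on $A$: a homomorphism $s\mapsto\theta_s$ from $S$ to the monoid of partial bijections of $A$ with $\theta_1=\mathrm{id}_A$ such that, for every $s\in S$, there is a central idempotent $1_s\in A$ with $\operatorname{ran}\theta_s=1_sA$ (so that $\operatorname{dom}\theta_s=1_{s^{-1}}A$) and $\theta_s:1_{s^{-1}}A\to 1_sA$ is an isomorphism of $K$-algebras. Let $L=\bigoplus_{s\in S}1_sA\,\delta_s$ with the product $a\delta_s\cdot b\delta_t=a\,\theta_s(1_{s^{-1}}b)\,\delta_{st}$, let $\mathcal N$ be the two-sided ideal of $L$ generated by all $a\delta_s-a\delta_t$ with $a\in 1_sA$ and $s\le t$ (the natural partial order), and let $\Lambda=A\rtimes_\theta S=L/\mathcal N$ be the crossed product; write $\overline{w}$ for the class of $w\in L$. For a $K$-algebra $R$ put $R^e=R\otimes_K R^{\mathrm{op}}$ and identify $R$-bimodules with left $R^e$-modules. Every $\Lambda$-bimodule $M$ is an $A$-bimodule via $a\mapsto\overline{a\delta_1}$, and $\operatorname{Hom}_{A^e}(A,M)$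 is a left $KS$-module via $$(s\cdot f)(a)=\overline{1_s\delta_s}\; f\bigl(\theta_{s^{-1}}(1_s a)\bigr)\;\overline{1_{s^{-1}}\delta_{s^{-1}}}.$$ This defines a left exact functor $T_1=\operatorname{Hom}_{A^e}(A,-)$ from $\Lambda^e$-modules to left $KS$-modules; let $R^qT_1$ be its right derived functors. Let $KE(S)$ be the free $K$-module on the set $E(S)$ of idempotents of $S$, with the left $KS$-module structure $s\cdot e=ses^{-1}$. For a left $KS$-module $V$ put $H^p(S,V)=\operatorname{Ext}^p_{KS}(KE(S),V)$, and let $H^n(\Lambda,M)=\operatorname{Ext}^n_{\Lambda^e}(\Lambda,M)$ be Hochschild cohomology. Then for every $\Lambda$-bimodule $M$ there exists a cohomological spectral sequence of $K$-modules $(E_r^{p,q},d_r)_{r\ge 2}$, with $d_r$ of bidegree $(r,1-r)$ and concentrated in $p,q\ge 0$ (a "third quadrant" spectral sequence after the re-indexing $E_{-p,-q}=E^{p,q}$), such that $$E_2^{p,q}\cong H^p\bigl(S,(R^qT_1)M\bigr)\Longrightarrow H^{p+q}(A\rtimes_\theta S,M).$$ That is, for every $n\ge 0$ the $K$-module $H^n(A\rtimes_\theta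 S,M)$ has a decreasing filtration $H^n=F^0\supseteq F^1\supseteq\dots\supseteq F^{n+1}=0$ with $F^p/F^{p+1}\cong E_\infty^{p,q}$ for all $p,q\ge 0$ with $p+q=n$. -/

import Mathlib

open CategoryTheory TensorProduct MulOpposite
open scoped ModuleCat

universe u

/-- An inverse monoid: every `s` has a unique `s⁻¹` with `s s⁻¹ s = s` and `s⁻¹ s s⁻¹ = s⁻¹`. -/
class InverseMonoid (S : Type*) extends Monoid S, Inv S where
  mul_inv_mul (s : S) : s * s⁻¹ * s = s
  inv_mul_inv (s : S) : s⁻¹ * s * s⁻¹ = s⁻¹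
  inv_unique (s t : S) : s * t * s = s → t * s * t = t → t = s⁻¹

namespace InverseMonoid

section Basic

variable {S : Type*} [InverseMonoid S]

theorem inv_inv' (s : S) : s⁻¹⁻¹ = s :=
  (inv_unique s⁻¹ s (inv_mul_inv s) (mul_inv_mul s)).symm

theorem inv_of_idem {e : S} (he : e * e = e) : e⁻¹ = e :=
  (inv_unique e e (by rw [he, he]) (by rw [he, he])).symm

theorem one_inv : (1 : S)⁻¹ = 1 := inv_of_idem (mul_one 1)

theorem idem_mul {e f : S} (he : e * e = e) (hf : f * f = f) : (e * f) * (e * f) = e * f := by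
  have h1 := mul_inv_mul (e * f)
  have h2 := inv_mul_inv (e * f)
  generalize hx : (e * f)⁻¹ = x at h1 h2
  have hy : f * x * e = x := by
    rw [← hx]
    apply inv_unique
    · rw [hx]
      calc e * f * (f * x * e) * (e * f) = e * (f * f) * x * (e * e) * f := by
            simp only [mul_assoc]
        _ = e * f * x * (e * f) := by rw [he, hf]; simp only [mul_assoc]
        _ = _ := h1
    · rw [hx]
      calc f * x * e * (e * f) * (f * x * e) = f * (x * ((e * e) * (f * f)) * x) * e := by
            simp only [mul_assoc]
        _ = _ := by rw [he, hf, h2]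
  have hidem : x * x = x := by
    calc x * x = (f * x * e) * (f * x * e) := by rw [hy]
      _ = f * (x * (e * f) * x) * e := by simp only [mul_assoc]
      _ = x := by rw [h2, hy]
  have h3 : e * f = x⁻¹ := by rw [← hx, inv_inv']
  rw [h3, inv_of_idem hidem, hidem]

theorem idem_comm {e f : S} (he : e * e = e) (hf : f * f = f) : e * f = f * e := by
  have hef := idem_mul he hf
  have hfe := idem_mul hf he
  have h : f * e = (e * f)⁻¹ := by
    apply inv_unique
    · calc e * f * (f * e) * (e * f) = e * (f * f) * (e * e) * f := by simp only [mul_assoc]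
        _ = e * f * (e * f) := by rw [he, hf]; simp only [mul_assoc]
        _ = _ := hef
    · calc f * e * (e * f) * (f * e) = f * (e * e) * (f * f) * e := by simp only [mul_assoc]
        _ = f * e * (f * e) := by rw [he, hf]; simp only [mul_assoc]
        _ = _ := hfe
  rw [h, inv_of_idem hef]

theorem mul_inv_idem (s : S) : (s * s⁻¹) * (s * s⁻¹) = s * s⁻¹ := by
  rw [← mul_assoc, mul_inv_mul]

theorem inv_mul_idem (s : S) : (s⁻¹ * s) * (s⁻¹ * s) = s⁻¹ * s := by
  rw [← mul_assoc, inv_mul_inv]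

theorem mul_inv_rev' (s t : S) : (s * t)⁻¹ = t⁻¹ * s⁻¹ := by
  have hc := idem_comm (mul_inv_idem t) (inv_mul_idem s)
  symm
  apply inv_unique
  · calc s * t * (t⁻¹ * s⁻¹) * (s * t) = s * ((t * t⁻¹) * (s⁻¹ * s)) * t := by
          simp only [mul_assoc]
      _ = (s * s⁻¹ * s) * (t * t⁻¹ * t) := by rw [hc]; simp only [mul_assoc]
      _ = _ := by rw [mul_inv_mul, mul_inv_mul]
  · calc t⁻¹ * s⁻¹ * (s * t) * (t⁻¹ * s⁻¹) = t⁻¹ * ((s⁻¹ * s) * (t * t⁻¹)) * s⁻¹ := by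
          simp only [mul_assoc]
      _ = (t⁻¹ * t * t⁻¹) * (s⁻¹ * s * s⁻¹) := by rw [← hc]; simp only [mul_assoc]
      _ = _ := by rw [inv_mul_inv, inv_mul_inv]

/-- The natural partial order: `s ≤ t` iff `s = e t` for some idempotent `e`. -/
def NatLE (s t : S) : Prop := ∃ e : S, IsIdempotentElem e ∧ s = e * t

variable (S) in
/-- The set `E(S)` of idempotents of `S`. -/
def Idem : Type _ := {e : S // IsIdempotentElem e}

/-- `S` acts on `E(S)` by `s · e = s e s⁻¹`. -/
instance : MulAction S (Idem S) where
  smul s e := ⟨s * e.1 * s⁻¹, by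
    have he : e.1 * e.1 = e.1 := e.2
    change (s * e.1 * s⁻¹) * (s * e.1 * s⁻¹) = s * e.1 * s⁻¹
    calc (s * e.1 * s⁻¹) * (s * e.1 * s⁻¹) = s * (e.1 * (s⁻¹ * s)) * e.1 * s⁻¹ := by
          simp only [mul_assoc]
      _ = (s * s⁻¹ * s) * (e.1 * e.1) * s⁻¹ := by
          rw [idem_comm he (inv_mul_idem s)]; simp only [mul_assoc]
      _ = _ := by rw [mul_inv_mul, he]⟩
  one_smul e := Subtype.ext (by
    change 1 * e.1 * (1 : S)⁻¹ = e.1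
    rw [one_inv, one_mul, mul_one])
  mul_smul s t e := Subtype.ext (by
    change s * t * e.1 * (s * t)⁻¹ = s * (t * e.1 * t⁻¹) * s⁻¹
    rw [mul_inv_rev']; simp only [mul_assoc])

end Basic

/-- The trivial left `KS`-module `KE(S)`: the free `K`-module on `E(S)` with `s · e = s e s⁻¹`. -/
noncomputable def trivialModule (K S : Type u) [CommRing K] [InverseMonoid S] :
    ModuleCat.{u} (MonoidAlgebra K S) :=
  ModuleCat.of (MonoidAlgebra K S) (Representation.ofMulAction K S (Idem S)).asModule

/-- The cohomology `Hⁿ(S, V) = Extⁿ_{KS}(KE(S), V)` of an inverse monoid. -/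
noncomputable def cohomology {K S : Type u} [Field K] [InverseMonoid S]
    (V : ModuleCat.{u} (MonoidAlgebra K S)) (n : ℕ) : ModuleCat.{u} K :=
  ModuleCat.of K (Abelian.Ext (trivialModule K S) V n)

end InverseMonoid

/-- The enveloping algebra `Rᵉ = R ⊗ Rᵒᵖ`; left `Rᵉ`-modules are `R`-bimodules through
`(a ⊗ b) · x = a x b`. -/
abbrev Envelope (K R : Type*) [CommRing K] [Ring R] [Algebra K R] : Type _ := R ⊗[K] Rᵐᵒᵖ

/-- `R` as a left `Rᵉ`-module (that is, as an `R`-bimodule), `(a ⊗ b) · x = a x b`. -/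
noncomputable def regularBimodule (K R : Type u) [CommRing K] [Ring R] [Algebra K R] :
    ModuleCat.{u} (Envelope K R) :=
  letI : Module (Envelope K R) R := instModuleTensorProductMop K R
  ModuleCat.of (Envelope K R) R

/-- The Hochschild cohomology `Hⁿ(R, M) = Extⁿ_{Rᵉ}(R, M)` of an algebra over a field. -/
noncomputable def hochschildCohomology {K R : Type u} [Field K] [Ring R] [Algebra K R]
    (M : ModuleCat.{u} (Envelope K R)) (n : ℕ) : ModuleCat.{u} K :=
  ModuleCat.of K (Abelian.Ext (regularBimodule K R) M n)

/-- A unital action of an inverse monoid `S` on a `K`-algebra `A`: a homomorphism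
`s ↦ θ_s` from `S` to the symmetric inverse monoid of partial bijections of `A`, with
`θ_1 = id`, such that the range of `θ_s` is the ideal `1_s A` for a central idempotent `1_s`
(hence the domain, which is the range of `θ_{s⁻¹}`, is `1_{s⁻¹} A`), and `θ_s` is an
isomorphism of (non-unital) algebras from its domain to its range. -/
structure UnitalAction (K S A : Type*) [CommRing K] [InverseMonoid S] [Ring A] [Algebra K A] where
  /-- the partial bijection `θ_s`; `b ∈ θ s a` means that `a ∈ dom θ_s` and `θ_s(a) = b` -/
  pequiv : S → (A ≃. A)
  map_one : pequiv 1 = PEquiv.refl A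
  map_mul (s t : S) : pequiv (s * t) = (pequiv t).trans (pequiv s)
  /-- the central idempotent `1_s` -/
  unit : S → A
  unit_idem (s : S) : unit s * unit s = unit s
  unit_central (s : S) (a : A) : unit s * a = a * unit s
  range_eq (s : S) (b : A) : (∃ a, b ∈ pequiv s a) ↔ ∃ c, b = unit s * c
  add_mem {s : S} {a a' b b' : A} :
    b ∈ pequiv s a → b' ∈ pequiv s a' → b + b' ∈ pequiv s (a + a')
  mul_mem {s : S} {a a' b b' : A} :
    b ∈ pequiv s a → b' ∈ pequiv s a' → b * b' ∈ pequiv s (a * a')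
  smul_mem (r : K) {s : S} {a b : A} : b ∈ pequiv s a → r • b ∈ pequiv s (r • a)

namespace UnitalAction

open InverseMonoid

section Action

variable {K S A : Type*} [CommRing K] [InverseMonoid S] [Ring A] [Algebra K A]
variable (θ : UnitalAction K S A)

theorem range_iff (s : S) (b : A) : (∃ a, b ∈ θ.pequiv s a) ↔ θ.unit s * b = b := by
  rw [θ.range_eq]
  constructor
  · rintro ⟨c, rfl⟩; rw [← mul_assoc, θ.unit_idem]
  · intro h; exact ⟨b, h.symm⟩

theorem comp_mem {s t : S} {a b c : A} (hb : b ∈ θ.pequiv t a) (hc : c ∈ θ.pequiv s b) :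
    c ∈ θ.pequiv (s * t) a := by
  rw [θ.map_mul, PEquiv.mem_trans]; exact ⟨b, hb, hc⟩

theorem mem_inv {s : S} {a b : A} (h : b ∈ θ.pequiv s a) : a ∈ θ.pequiv s⁻¹ b := by
  have h1 : b ∈ θ.pequiv (s * s⁻¹ * s) a := by rw [mul_inv_mul]; exact h
  rw [θ.map_mul, PEquiv.mem_trans] at h1
  obtain ⟨b1, hb1, h2⟩ := h1
  obtain rfl : b1 = b := Option.mem_unique hb1 h
  rw [θ.map_mul, PEquiv.mem_trans] at h2
  obtain ⟨a', ha', h3⟩ := h2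
  obtain rfl : a' = a := (θ.pequiv s).inj h3 h
  exact ha'

theorem dom_iff (s : S) (a : A) : (∃ b, b ∈ θ.pequiv s a) ↔ θ.unit s⁻¹ * a = a := by
  rw [← θ.range_iff]
  constructor
  · rintro ⟨b, h⟩; exact ⟨b, θ.mem_inv h⟩
  · rintro ⟨b, h⟩
    refine ⟨b, ?_⟩
    have := θ.mem_inv h
    rwa [inv_inv'] at this

theorem unit_one : θ.unit 1 = 1 := by
  have h : ∃ a, (1 : A) ∈ θ.pequiv 1 a := ⟨1, by rw [θ.map_one]; rfl⟩
  simpa using (θ.range_iff 1 1).1 h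

/-- The total operation `s · a = θ_s(1_{s⁻¹} a)`; the default value `0` is never used, because
`1_{s⁻¹} a` always lies in the domain of `θ_s`. -/
noncomputable def act (s : S) (a : A) : A := (θ.pequiv s (θ.unit s⁻¹ * a)).getD 0

theorem act_mem (s : S) (a : A) : θ.act s a ∈ θ.pequiv s (θ.unit s⁻¹ * a) := by
  have h : ∃ b, b ∈ θ.pequiv s (θ.unit s⁻¹ * a) :=
    (θ.dom_iff s _).2 (by rw [← mul_assoc, θ.unit_idem])
  obtain ⟨b, hb⟩ := h
  have hb' : θ.pequiv s (θ.unit s⁻¹ * a) = some b := hb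
  have : θ.act s a = b := by rw [act, hb']; rfl
  rw [this]; exact hb

theorem act_eq {s : S} {a b : A} (h : b ∈ θ.pequiv s (θ.unit s⁻¹ * a)) : θ.act s a = b :=
  Option.mem_unique (θ.act_mem s a) h

theorem unit_mul_act (s : S) (a : A) : θ.unit s * θ.act s a = θ.act s a :=
  (θ.range_iff s _).1 ⟨_, θ.act_mem s a⟩

theorem act_add (s : S) (a b : A) : θ.act s (a + b) = θ.act s a + θ.act s b :=
  θ.act_eq (by rw [mul_add]; exact θ.add_mem (θ.act_mem s a) (θ.act_mem s b))

theorem act_smul (s : S) (r : K) (a : A) : θ.act s (r • a) = r • θ.act s a :=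
  θ.act_eq (by rw [mul_smul_comm]; exact θ.smul_mem r (θ.act_mem s a))

theorem act_zero (s : S) : θ.act s 0 = 0 := by
  have := θ.act_add s 0 0
  simpa using this

theorem act_mul (s : S) (a b : A) : θ.act s (a * b) = θ.act s a * θ.act s b := by
  apply θ.act_eq
  have h : θ.unit s⁻¹ * (a * b) = (θ.unit s⁻¹ * a) * (θ.unit s⁻¹ * b) := by
    rw [mul_assoc (θ.unit s⁻¹) a, ← mul_assoc a (θ.unit s⁻¹) b, ← θ.unit_central s⁻¹ a,
      mul_assoc (θ.unit s⁻¹) a b, ← mul_assoc (θ.unit s⁻¹) (θ.unit s⁻¹), θ.unit_idem]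
  rw [h]
  exact θ.mul_mem (θ.act_mem s a) (θ.act_mem s b)

theorem act_one (a : A) : θ.act 1 a = a := by
  apply θ.act_eq
  rw [one_inv, θ.unit_one, one_mul, θ.map_one]; rfl

theorem act_comp (s t : S) (a : A) : θ.act (s * t) a = θ.act s (θ.act t a) := by
  apply θ.act_eq
  set d := θ.unit (s * t)⁻¹ with hd
  have hb := θ.act_mem t a
  set b := θ.act t a with hbdef
  have hs := θ.act_mem s b
  have hran : ∃ a', (θ.unit s⁻¹ * b) ∈ θ.pequiv t a' := by
    rw [θ.range_iff, ← mul_assoc, θ.unit_central t (θ.unit s⁻¹), mul_assoc, hbdef,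
      θ.unit_mul_act]
  obtain ⟨a', ha'⟩ := hran
  have hda' : d * a' = a' := (θ.dom_iff (s * t) a').1 ⟨_, θ.comp_mem ha' hs⟩
  obtain ⟨x, hx⟩ := (θ.dom_iff (s * t) d).2 (θ.unit_idem _)
  rw [θ.map_mul, PEquiv.mem_trans] at hx
  obtain ⟨y, hy, hyx⟩ := hx
  have hsy : θ.unit s⁻¹ * y = y := (θ.dom_iff s y).1 ⟨_, hyx⟩
  have htd : θ.unit t⁻¹ * d = d := (θ.dom_iff t d).1 ⟨_, hy⟩
  have e1 : y * (θ.unit s⁻¹ * b) = θ.unit s⁻¹ * b :=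
    Option.mem_unique (by have := θ.mul_mem hy ha'; rwa [hda'] at this) ha'
  have e2 : y * b = θ.unit s⁻¹ * b := by
    rw [← e1, ← mul_assoc, ← θ.unit_central, hsy]
  have e3 : θ.unit s⁻¹ * b ∈ θ.pequiv t (d * a) := by
    have := θ.mul_mem hy hb
    rwa [e2, ← mul_assoc, ← θ.unit_central t⁻¹ d, htd] at this
  exact θ.comp_mem e3 hs

theorem act_act_inv (s : S) (a : A) : θ.act s (θ.act s⁻¹ a) = θ.unit s * a := by
  have h := θ.mem_inv (θ.act_mem s⁻¹ a)
  rw [inv_inv'] at h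
  apply θ.act_eq
  rw [θ.unit_mul_act]; exact h

theorem act_unit (s : S) : θ.act s 1 = θ.unit s := by
  have h1 : θ.act s 1 * θ.unit s = θ.unit s := by
    have h2 : θ.unit s = θ.act s (θ.act s⁻¹ 1) := by rw [act_act_inv, mul_one]
    calc θ.act s 1 * θ.unit s = θ.act s 1 * θ.act s (θ.act s⁻¹ 1) := by rw [← h2]
      _ = θ.unit s := by rw [← θ.act_mul, one_mul, ← h2]
  rw [← h1, ← θ.unit_central, θ.unit_mul_act]

theorem unit_mul_of_mem {s t : S} {a b : A} (hb : θ.unit t * b = b) :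
    θ.unit (s * t) * (a * θ.act s b) = a * θ.act s b := by
  have h : θ.act s b = θ.act (s * t) (θ.act t⁻¹ b) := by
    rw [act_comp, act_act_inv, hb]
  rw [← mul_assoc, θ.unit_central, mul_assoc, h, θ.unit_mul_act]

/-- The product `(a δ_s)(b δ_t) = a θ_s(1_{s⁻¹} b) δ_{st}`, extended bilinearly. -/
noncomputable def mulAux : (S →₀ A) →ₗ[K] (S →₀ A) →ₗ[K] (S →₀ A) :=
  LinearMap.mk₂ K
    (fun f g => f.sum fun s a => g.sum fun t b => Finsupp.single (s * t) (a * θ.act s b))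
    (fun f f' g => by
      apply Finsupp.sum_add_index'
      · intro s; simp
      · intro s a a'
        rw [← Finsupp.sum_add]
        simp only [add_mul, Finsupp.single_add])
    (fun r f g => by
      rw [Finsupp.sum_smul_index' (by intro s; simp), Finsupp.smul_sum]
      simp only [Finsupp.smul_sum, Finsupp.smul_single, smul_mul_assoc])
    (fun f g g' => by
      rw [← Finsupp.sum_add]
      congr 1; ext1 s; ext1 a
      apply Finsupp.sum_add_index'
      · intro t; simp [act_zero]
      · intro t b b'; rw [act_add, mul_add, Finsupp.single_add])
    (fun r f g => by
      rw [Finsupp.smul_sum]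
      congr 1; ext1 s; ext1 a
      rw [Finsupp.sum_smul_index' (by intro t; simp [act_zero]), Finsupp.smul_sum]
      simp only [act_smul, mul_smul_comm, Finsupp.smul_single])

theorem mulAux_single (s t : S) (a b : A) :
    θ.mulAux (Finsupp.single s a) (Finsupp.single t b) =
      Finsupp.single (s * t) (a * θ.act s b) := by
  simp [mulAux, act_zero]

theorem mulAux_assoc (f g h : S →₀ A) :
    θ.mulAux (θ.mulAux f g) h = θ.mulAux f (θ.mulAux g h) := by
  induction f using Finsupp.induction_linear with
  | zero => simp
  | add f f' hf hf' => simp only [_root_.map_add, LinearMap.add_apply, hf, hf']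
  | single s a =>
    induction g using Finsupp.induction_linear with
    | zero => simp
    | add g g' hg hg' => simp only [_root_.map_add, LinearMap.add_apply, hg, hg']
    | single t b =>
      induction h using Finsupp.induction_linear with
      | zero => simp
      | add h h' hh hh' => simp only [_root_.map_add, hh, hh']
      | single v c =>
        simp only [mulAux_single, act_mul, act_comp, mul_assoc]

theorem one_mulAux (f : S →₀ A) : θ.mulAux (Finsupp.single 1 1) f = f := by
  induction f using Finsupp.induction_linear with
  | zero => simp
  | add f f' hf hf' => simp only [_root_.map_add, hf, hf']
  | single s a => rw [mulAux_single, act_one, one_mul, one_mul]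

/-- The `K`-module `L(A, θ, S) = ⨁_{s ∈ S} 1_s A δ_s`: the finitely supported `f : S → A` with
`f s ∈ 1_s A` for all `s`. -/
noncomputable def skewSum : Submodule K (S →₀ A) where
  carrier := {f | ∀ s, θ.unit s * f s = f s}
  add_mem' hf hg s := by rw [Finsupp.add_apply, mul_add, hf s, hg s]
  zero_mem' s := by simp
  smul_mem' r f hf s := by rw [Finsupp.smul_apply, mul_smul_comm, hf s]

theorem single_mem {s : S} {a : A} (h : θ.unit s * a = a) :
    Finsupp.single s a ∈ θ.skewSum := by
  classical
  intro t
  rw [Finsupp.single_apply]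
  split_ifs with hst
  · subst hst; exact h
  · simp

theorem mulAux_mem {f g : S →₀ A} (hg : g ∈ θ.skewSum) :
    θ.mulAux f g ∈ θ.skewSum := by
  change (f.sum fun s a => g.sum fun t b => Finsupp.single (s * t) (a * θ.act s b)) ∈ _
  apply Submodule.sum_mem
  intro s _
  apply Submodule.sum_mem
  intro t _
  exact θ.single_mem (θ.unit_mul_of_mem (hg t))

theorem mulAux_one {f : S →₀ A} (hf : f ∈ θ.skewSum) :
    θ.mulAux f (Finsupp.single 1 1) = f := by
  change (f.sum fun s a => (Finsupp.single (1 : S) (1 : A)).sum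
    fun t b => Finsupp.single (s * t) (a * θ.act s b)) = f
  conv_rhs => rw [← Finsupp.sum_single f]
  apply Finsupp.sum_congr
  intro s _
  rw [Finsupp.sum_single_index (by simp [act_zero]), mul_one, act_unit, ← θ.unit_central, hf s]

noncomputable instance : Ring θ.skewSum where
  __ := (inferInstance : AddCommGroup θ.skewSum)
  mul f g := ⟨θ.mulAux f.1 g.1, θ.mulAux_mem g.2⟩
  one := ⟨Finsupp.single 1 1, θ.single_mem (by rw [θ.unit_one, mul_one])⟩
  mul_assoc f g h := Subtype.ext (θ.mulAux_assoc f.1 g.1 h.1)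
  one_mul f := Subtype.ext (θ.one_mulAux f.1)
  mul_one f := Subtype.ext (θ.mulAux_one f.2)
  left_distrib f g h := Subtype.ext ((θ.mulAux f.1).map_add g.1 h.1)
  right_distrib f g h := Subtype.ext (θ.mulAux.map_add₂ f.1 g.1 h.1)
  zero_mul f := Subtype.ext (θ.mulAux.map_zero₂ f.1)
  mul_zero f := Subtype.ext ((θ.mulAux f.1).map_zero)

noncomputable instance : Algebra K θ.skewSum :=
  Algebra.ofModule
    (fun r f g => Subtype.ext (θ.mulAux.map_smul₂ r f.1 g.1))
    (fun r f g => Subtype.ext ((θ.mulAux f.1).map_smul r g.1))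

/-- The two-sided ideal `𝒩` of `L(A, θ, S)` generated by the elements `a δ_s - a δ_t` with
`a ∈ 1_s A` and `s ≤ t`. -/
noncomputable def ideal : TwoSidedIdeal θ.skewSum :=
  TwoSidedIdeal.span {x | ∃ (s t : S) (a : A), NatLE s t ∧ θ.unit s * a = a ∧
    (x : S →₀ A) = Finsupp.single s a - Finsupp.single t a}

/-- The crossed product `A ⋊_θ S = L(A, θ, S) / 𝒩`. -/
def CrossedProduct : Type _ := θ.ideal.ringCon.Quotient

noncomputable instance : Ring θ.CrossedProduct :=
  inferInstanceAs (Ring θ.ideal.ringCon.Quotient)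

noncomputable instance : Algebra K θ.CrossedProduct :=
  inferInstanceAs (Algebra K θ.ideal.ringCon.Quotient)

/-- The quotient map `L(A, θ, S) → A ⋊_θ S`. -/
noncomputable def quot : θ.skewSum →ₐ[K] θ.CrossedProduct :=
  RingCon.mkₐ (α := K) θ.ideal.ringCon

/-- The algebra homomorphism `A → L(A, θ, S)`, `a ↦ a δ_1`. -/
noncomputable def inclL : A →ₐ[K] θ.skewSum :=
  AlgHom.ofLinearMap
    { toFun a := ⟨Finsupp.single 1 a, θ.single_mem (by rw [θ.unit_one, one_mul])⟩
      map_add' a b := Subtype.ext (Finsupp.single_add _ _ _)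
      map_smul' r a := Subtype.ext (Finsupp.smul_single r _ _).symm }
    rfl
    (fun a b => Subtype.ext (by
      change Finsupp.single 1 (a * b) = θ.mulAux (Finsupp.single 1 a) (Finsupp.single 1 b)
      rw [mulAux_single, act_one, mul_one]))

/-- The monoid homomorphism `S → L(A, θ, S)`, `s ↦ 1_s δ_s`. -/
noncomputable def deltaL : S →* θ.skewSum where
  toFun s := ⟨Finsupp.single s (θ.unit s), θ.single_mem (θ.unit_idem s)⟩
  map_one' := Subtype.ext (by
    change Finsupp.single 1 (θ.unit 1) = Finsupp.single 1 1
    rw [θ.unit_one])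
  map_mul' s t := Subtype.ext (by
    change Finsupp.single (s * t) (θ.unit (s * t)) =
      θ.mulAux (Finsupp.single s (θ.unit s)) (Finsupp.single t (θ.unit t))
    rw [mulAux_single, ← θ.act_unit t, ← act_comp, act_unit, ← θ.act_unit (s * t), act_comp,
      unit_mul_act])

theorem deltaL_mul_inclL (s : S) (a : A) :
    θ.deltaL s * θ.inclL a = θ.inclL (θ.act s a) * θ.deltaL s := Subtype.ext (by
  change θ.mulAux (Finsupp.single s (θ.unit s)) (Finsupp.single 1 a) =
    θ.mulAux (Finsupp.single 1 (θ.act s a)) (Finsupp.single s (θ.unit s))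
  rw [mulAux_single, mulAux_single, mul_one, one_mul, act_one, θ.unit_central])

theorem inclL_unit_mul (s : S) (a : A) :
    θ.inclL (θ.unit s * a) * θ.deltaL s = θ.inclL a * θ.deltaL s := Subtype.ext (by
  change θ.mulAux (Finsupp.single 1 (θ.unit s * a)) (Finsupp.single s (θ.unit s)) =
    θ.mulAux (Finsupp.single 1 a) (Finsupp.single s (θ.unit s))
  rw [mulAux_single, mulAux_single, act_one, θ.unit_central s a, mul_assoc, θ.unit_idem])

/-- The algebra homomorphism `A → A ⋊_θ S`, `a ↦ a δ_1 + 𝒩`. -/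
noncomputable def incl : A →ₐ[K] θ.CrossedProduct := θ.quot.comp θ.inclL

/-- The monoid homomorphism `S → A ⋊_θ S`, `s ↦ 1_s δ_s + 𝒩`. -/
noncomputable def delta : S →* θ.CrossedProduct :=
  (θ.quot : θ.skewSum →* θ.CrossedProduct).comp θ.deltaL

theorem delta_mul_incl (s : S) (a : A) :
    θ.delta s * θ.incl a = θ.incl (θ.act s a) * θ.delta s := by
  have := congrArg θ.quot (θ.deltaL_mul_inclL s a)
  rw [_root_.map_mul, _root_.map_mul] at this
  exact this

theorem incl_unit_mul (s : S) (a : A) :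
    θ.incl (θ.unit s * a) * θ.delta s = θ.incl a * θ.delta s := by
  have := congrArg θ.quot (θ.inclL_unit_mul s a)
  rw [_root_.map_mul θ.quot, _root_.map_mul θ.quot] at this
  exact this

/-- The algebra homomorphism `Aᵉ → (A ⋊_θ S)ᵉ` induced by `A → A ⋊_θ S`. -/
noncomputable def envIncl : Envelope K A →ₐ[K] Envelope K θ.CrossedProduct :=
  Algebra.TensorProduct.map θ.incl (AlgHom.op θ.incl)

/-- The element of `(A ⋊_θ S)ᵉ` acting on bimodules by
`s · x = (1_s δ_s) x (1_{s⁻¹} δ_{s⁻¹})`. -/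
noncomputable def conj : S →* Envelope K θ.CrossedProduct where
  toFun s := θ.delta s ⊗ₜ op (θ.delta s⁻¹)
  map_one' := by rw [one_inv, _root_.map_one]; rfl
  map_mul' s t := by
    rw [Algebra.TensorProduct.tmul_mul_tmul, mul_inv_rev', _root_.map_mul, _root_.map_mul, op_mul]

end Action

section Functor

attribute [local instance] instModuleTensorProductMop

variable {K S A : Type*} [Field K] [InverseMonoid S] [Ring A] [Algebra K A]
variable (θ : UnitalAction K S A)
variable (M : Type*) [AddCommGroup M] [Module (Envelope K θ.CrossedProduct) M]

/-- `Hom_{Aᵉ}(A, M)` for an `A ⋊_θ S`-bimodule `M`, where `Aᵉ` acts on `M` through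
`Aᵉ → (A ⋊_θ S)ᵉ`: the additive maps `f : A → M` with `f (x • a) = x • f a` for `x ∈ Aᵉ`. -/
abbrev HomAe : Type _ := A →ₛₗ[(θ.envIncl : Envelope K A →+* Envelope K θ.CrossedProduct)] M

variable {M}

theorem conj_envIncl_smul (s : S) (x : Envelope K A) (a : A) (f : θ.HomAe M) :
    θ.conj s • f (θ.act s⁻¹ (x • a)) = θ.envIncl x • θ.conj s • f (θ.act s⁻¹ a) := by
  induction x using TensorProduct.induction_on with
  | zero =>
    have h0 : (0 : Envelope K A) • a = 0 := zero_smul (Envelope K A) a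
    have h1 : θ.conj s • f (θ.act s⁻¹ ((0 : Envelope K A) • a)) = 0 := by
      rw [h0, act_zero, _root_.map_zero, smul_zero]
    have h2 : θ.envIncl (0 : Envelope K A) • θ.conj s • f (θ.act s⁻¹ a) = 0 := by
      rw [_root_.map_zero]
      exact zero_smul (Envelope K θ.CrossedProduct) (θ.conj s • f (θ.act s⁻¹ a))
    exact h1.trans h2.symm
  | add x y hx hy =>
    rw [add_smul, act_add, _root_.map_add, smul_add, hx, hy, _root_.map_add, add_smul]
  | tmul b c =>
    have h1 : (b ⊗ₜ[K] c : Envelope K A) • a = b * (a * c.unop) := rfl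
    have h2 : θ.act s⁻¹ ((b ⊗ₜ[K] c : Envelope K A) • a) =
        ((θ.act s⁻¹ b) ⊗ₜ[K] op (θ.act s⁻¹ c.unop) : Envelope K A) • θ.act s⁻¹ a := by
      rw [h1, act_mul, act_mul]; rfl
    rw [h2, LinearMap.map_smulₛₗ, smul_smul, smul_smul]
    congr 1
    change (θ.delta s ⊗ₜ[K] op (θ.delta s⁻¹)) *
        (θ.incl (θ.act s⁻¹ b) ⊗ₜ[K] op (θ.incl (θ.act s⁻¹ c.unop))) =
      (θ.incl b ⊗ₜ[K] op (θ.incl c.unop)) * (θ.delta s ⊗ₜ[K] op (θ.delta s⁻¹))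
    rw [Algebra.TensorProduct.tmul_mul_tmul, Algebra.TensorProduct.tmul_mul_tmul,
      ← op_mul, ← op_mul, delta_mul_incl, act_act_inv, incl_unit_mul, delta_mul_incl]

variable [Module K M] [IsScalarTower K (Envelope K θ.CrossedProduct) M]

variable (M) in
/-- `Hom_{Aᵉ}(A, M)` as a representation of `S`, with `(s · f)(a) = s · f(s⁻¹ · a)`. -/
noncomputable def homRep : Representation K S (θ.HomAe M) where
  toFun s :=
    { toFun f :=
        { toFun a := θ.conj s • f (θ.act s⁻¹ a)
          map_add' a b := by rw [act_add, _root_.map_add, smul_add]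
          map_smul' x a := θ.conj_envIncl_smul s x a f }
      map_add' f g := LinearMap.ext fun a => smul_add _ _ _
      map_smul' r f := LinearMap.ext fun a => smul_comm _ _ _ }
  map_one' := by
    ext f a
    change θ.conj 1 • f (θ.act 1⁻¹ a) = f a
    rw [one_inv, act_one, _root_.map_one, one_smul]
  map_mul' s t := by
    ext f a
    change θ.conj (s * t) • f (θ.act (s * t)⁻¹ a) =
      θ.conj s • θ.conj t • f (θ.act t⁻¹ (θ.act s⁻¹ a))
    rw [mul_inv_rev', act_comp, _root_.map_mul, mul_smul]

end Functor

section T1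

attribute [local instance] instModuleTensorProductMop

variable {K S A : Type u} [Field K] [InverseMonoid S] [Ring A] [Algebra K A]
variable (θ : UnitalAction K S A)

/-- Composition with a homomorphism `g` of `A ⋊_θ S`-bimodules, as a `K`-linear map. -/
noncomputable def homComp {M N : ModuleCat.{u} (Envelope K θ.CrossedProduct)} (g : M ⟶ N) :
    θ.HomAe M →ₗ[K] θ.HomAe N where
  toFun f := g.hom.comp f
  map_add' f f' := LinearMap.comp_add _ _ _
  map_smul' r f := LinearMap.ext fun a => by
    change g.hom (r • f a) = r • g.hom (f a)
    rw [← algebraMap_smul (Envelope K θ.CrossedProduct) r (f a), g.hom.map_smul, algebraMap_smul]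

theorem homComp_homRep {M N : ModuleCat.{u} (Envelope K θ.CrossedProduct)} (g : M ⟶ N)
    (s : S) (f : θ.HomAe M) :
    θ.homComp g (θ.homRep M s f) = θ.homRep N s (θ.homComp g f) :=
  LinearMap.ext fun _ => g.hom.map_smul _ _

/-- Composition with a homomorphism `g` of `A ⋊_θ S`-bimodules, as a `KS`-linear map. -/
noncomputable def homMap {M N : ModuleCat.{u} (Envelope K θ.CrossedProduct)} (g : M ⟶ N) :
    (θ.homRep M).asModule →ₗ[MonoidAlgebra K S] (θ.homRep N).asModule :=
  MonoidAlgebra.equivariantOfLinearOfComm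
    ((θ.homRep N).asModuleEquiv.symm.toLinearMap ∘ₗ θ.homComp g ∘ₗ
      (θ.homRep M).asModuleEquiv.toLinearMap)
    (fun s f => by
      rw [Representation.single_smul, Representation.single_smul, one_smul, one_smul]
      exact θ.homComp_homRep g s _)

/-- The functor `T₁ = Hom_{Aᵉ}(A, -)` from `(A ⋊_θ S)ᵉ`-modules to left `KS`-modules. -/
noncomputable def T1 :
    ModuleCat.{u} (Envelope K θ.CrossedProduct) ⥤ ModuleCat.{u} (MonoidAlgebra K S) where
  obj M := ModuleCat.of (MonoidAlgebra K S) (θ.homRep M).asModule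
  map g := ModuleCat.ofHom (θ.homMap g)
  map_id _ := rfl
  map_comp _ _ := rfl

instance : θ.T1.Additive where
  map_add := rfl

end T1

end UnitalAction

/-- The module `E_∞^{p,q}` of a first quadrant cohomological spectral sequence. For `r ≥ p + q + 2`
the differentials `d_r` into and out of position `(p, q)` are zero (they would start or end outside
the quadrant), so that the terms `E_r^{p,q}` for these `r` are all isomorphic; the term with
`r = p + q + 2` is taken as `E_∞^{p,q}`. -/
noncomputable def pageInfinity {K : Type u} [Field K]
    (E : E₂CohomologicalSpectralSequenceNat (ModuleCat.{u} K)) (p q : ℕ) : ModuleCat.{u} K :=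
  (E.page ((p : ℤ) + q + 2)).X (p, q)

/-- Convergence `E₂^{p,q} ⇒ H^{p+q}`: every `H^n` has a finite decreasing filtration
`H^n = F^0 ⊇ F^1 ⊇ ⋯ ⊇ F^{n+1} = 0` with `F^p / F^{p+1} ≅ E_∞^{p,q}` whenever `p + q = n`. -/
def ConvergesTo {K : Type u} [Field K]
    (E : E₂CohomologicalSpectralSequenceNat (ModuleCat.{u} K)) (H : ℕ → ModuleCat.{u} K) : Prop :=
  ∀ n : ℕ, ∃ F : ℕ → Submodule K (H n), Antitone F ∧ F 0 = ⊤ ∧ F (n + 1) = ⊥ ∧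
    ∀ p q : ℕ, p + q = n →
      Nonempty ((F p ⧸ (F (p + 1)).submoduleOf (F p)) ≃ₗ[K] pageInfinity E p q)

/-!
The spectral sequence is the Grothendieck spectral sequence of the functor `T₁`, obtained from two
facts. First, `T₁` preserves injectives: it has the left adjoint `V ↦ Λ ⊗ V`, the tensor product
being over the algebra `KE` of the idempotents of `S`. As `KE` is commutative and von Neumann
regular, `Λ` is flat over it, so that this left adjoint is exact. Second,
`Hom_{KS}(KE(S), T₁ M)` and `Hom_{Λᵉ}(Λ, M)` are both the invariants `{m | x m = m x for x ∈ Λ}`.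

The pages of the Grothendieck spectral sequence come from a spectral object: for the image `X` under
`T₁` of an injective resolution of `M` and for the trivial module `B = KE(S)`, it consists of the
groups of morphisms from `B` to the shifts of the truncations of `X` in the derived category.
-/

section SpectralObject

open ComposableArrows

theorem nonempty_range_quotient_range_comp_equiv {R A B C E : Type*} [Ring R] [AddCommGroup A]
    [AddCommGroup B] [AddCommGroup C] [AddCommGroup E] [Module R A] [Module R B] [Module R C]
    [Module R E] (i : A →ₗ[R] B) (a : B →ₗ[R] C) (π : B →ₗ[R] E) (hπ : Function.Surjective π)
    (hker : LinearMap.ker π = LinearMap.range i ⊔ LinearMap.ker a) :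
    Nonempty ((LinearMap.range a ⧸
      (LinearMap.range (a ∘ₗ i)).submoduleOf (LinearMap.range a)) ≃ₗ[R] E) := by
  let g := ((LinearMap.range (a ∘ₗ i)).submoduleOf (LinearMap.range a)).mkQ ∘ₗ a.rangeRestrict
  have hg : Function.Surjective g :=
    (Submodule.mkQ_surjective _).comp a.surjective_rangeRestrict
  have hkg : LinearMap.ker g = LinearMap.ker π := by
    rw [LinearMap.ker_comp, Submodule.ker_mkQ, Submodule.submoduleOf, ← Submodule.comap_comp,
      LinearMap.subtype_comp_codRestrict, LinearMap.range_comp, Submodule.comap_map_eq, hker]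
  exact ⟨(g.quotKerEquivOfSurjective hg).symm ≪≫ₗ Submodule.quotEquivOfEq _ _ hkg ≪≫ₗ
    π.quotKerEquivOfSurjective hπ⟩

section

variable {R : Type*} [Ring R]

theorem range_hom_comp_le {M N P : ModuleCat.{u} R} (f : M ⟶ N) (g : N ⟶ P) :
    LinearMap.range (f ≫ g).hom ≤ LinearMap.range g.hom :=
  LinearMap.range_comp_le_range _ _

theorem range_hom_biprod_desc {M N P : ModuleCat.{u} R} (f : M ⟶ P) (g : N ⟶ P) :
    LinearMap.range (Limits.biprod.desc f g).hom =
      LinearMap.range f.hom ⊔ LinearMap.range g.hom := by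
  apply le_antisymm
  · have h : Limits.biprod.desc f g = Limits.biprod.fst ≫ f + Limits.biprod.snd ≫ g := by
      apply Limits.biprod.hom_ext' <;> simp
    rintro _ ⟨x, rfl⟩
    rw [h]
    exact Submodule.add_mem_sup ⟨_, rfl⟩ ⟨_, rfl⟩
  · refine sup_le ?_ ?_
    · simpa using range_hom_comp_le Limits.biprod.inl (Limits.biprod.desc f g)
    · simpa using range_hom_comp_le Limits.biprod.inr (Limits.biprod.desc f g)

variable (Y : Abelian.SpectralObject (ModuleCat.{u} R) EInt)

/-- The image of `Hⁿ(⊥ ≤ i)` in the abutment `Hⁿ(⊥ ≤ ⊤)` of a spectral object; these submodules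
form the filtration of the abutment. -/
noncomputable def abutmentRange (n : ℤ) (i : EInt) :
    Submodule R ((Y.H n).obj (mk₁ (homOfLE (bot_le : (⊥ : EInt) ≤ ⊤)))) :=
  LinearMap.range ((Y.H n).map (twoδ₂Toδ₁' ⊥ i ⊤ bot_le le_top)).hom

theorem map_twoδ₂Toδ₁'_comp (n : ℤ) {i j : EInt} (hij : i ≤ j) :
    (Y.H n).map (twoδ₂Toδ₁' ⊥ i j bot_le hij) ≫ (Y.H n).map (twoδ₂Toδ₁' ⊥ j ⊤ bot_le le_top) =
      (Y.H n).map (twoδ₂Toδ₁' ⊥ i ⊤ bot_le le_top) := by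
  rw [← Functor.map_comp]
  rfl

theorem abutmentRange_mono (n : ℤ) : Monotone (abutmentRange Y n) := fun i j hij => by
  rw [abutmentRange, ← map_twoδ₂Toδ₁'_comp Y n hij]
  exact range_hom_comp_le _ _

theorem abutmentRange_eq_top [Y.IsFirstQuadrant] {n i : ℤ} (h : n < i) :
    abutmentRange Y n (i : EInt) = ⊤ := by
  have hzero := Y.isZero₂_of_isFirstQuadrant (i : EInt) ⊤ le_top n (WithBotTop.coe_lt_coe.2 h)
  have hepi := (Y.exact₂ (homOfLE (bot_le : ⊥ ≤ (i : EInt))) (homOfLE le_top) (homOfLE bot_le)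
    rfl n).epi_f (hzero.eq_of_tgt _ _)
  exact LinearMap.range_eq_top.2 ((ModuleCat.epi_iff_surjective _).1 hepi)

theorem abutmentRange_eq_bot [Y.IsFirstQuadrant] (n : ℤ) {i : ℤ} (h : i ≤ 0) :
    abutmentRange Y n (i : EInt) = ⊥ := by
  have hzero := Y.isZero₁_of_isFirstQuadrant ⊥ (i : EInt) bot_le (WithBotTop.coe_le_coe.2 h) n
  rw [abutmentRange, hzero.eq_of_src ((Y.H n).map (twoδ₂Toδ₁' ⊥ (i : EInt) ⊤ bot_le le_top)) 0]
  exact LinearMap.range_zero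

theorem nonempty_abutmentRange_quotient_equiv (i j : EInt) (hij : i ≤ j) (n₀ n₁ n₂ : ℤ)
    (hn₁ : n₀ + 1 = n₁) (hn₂ : n₁ + 1 = n₂) :
    Nonempty ((abutmentRange Y n₁ j ⧸
      (abutmentRange Y n₁ i).submoduleOf (abutmentRange Y n₁ j)) ≃ₗ[R]
      Y.E (homOfLE (bot_le : ⊥ ≤ i)) (homOfLE hij) (homOfLE (le_top : j ≤ ⊤))
        n₀ n₁ n₂ hn₁ hn₂) := by
  rw [abutmentRange, abutmentRange, ← map_twoδ₂Toδ₁'_comp Y n₁ hij]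
  have hexact := Y.cokernelSequenceE_exact (homOfLE (bot_le : ⊥ ≤ i)) (homOfLE hij)
    (homOfLE (le_top : j ≤ ⊤)) (homOfLE bot_le) rfl n₀ n₁ n₂ hn₁ hn₂
  have hepi : Epi (Y.cokernelSequenceE (homOfLE (bot_le : ⊥ ≤ i)) (homOfLE hij)
    (homOfLE (le_top : j ≤ ⊤)) (homOfLE bot_le) rfl n₀ n₁ n₂ hn₁ hn₂).g := inferInstance
  have hδ := Y.exact₁ (homOfLE (bot_le : ⊥ ≤ j)) (homOfLE (le_top : j ≤ ⊤)) (homOfLE bot_le)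
    rfl n₀ n₁ hn₁
  rw [ShortComplex.moduleCat_exact_iff_range_eq_ker] at hexact hδ
  exact nonempty_range_quotient_range_comp_equiv _ _
    (Y.toCycles (homOfLE (bot_le : ⊥ ≤ i)) (homOfLE hij) (homOfLE bot_le) rfl n₁ ≫
      Y.πE _ _ (homOfLE (le_top : j ≤ ⊤)) n₀ n₁ n₂ hn₁ hn₂).hom
    ((ModuleCat.epi_iff_surjective _).1 hepi)
    (hexact.symm.trans ((range_hom_biprod_desc _ _).trans (congrArg₂ (· ⊔ ·) rfl hδ)))

end

variable {K : Type u} [Field K] (Y : Abelian.SpectralObject (ModuleCat.{u} K) EInt)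
  [Y.IsFirstQuadrant]

theorem nonempty_pageInfinity_iso (p q : ℕ) (n₀ n₁ n₂ : ℤ) (hn₁ : n₀ + 1 = n₁)
    (hn₂ : n₁ + 1 = n₂) (hpq : n₁ = p + q) (h : ((q : ℤ) : EInt) ≤ ((q + 1 : ℤ) : EInt)) :
    Nonempty (pageInfinity Y.E₂SpectralSequenceNat p q ≅
      Y.E (homOfLE (bot_le : ⊥ ≤ ((q : ℤ) : EInt))) (homOfLE h)
        (homOfLE (le_top : ((q + 1 : ℤ) : EInt) ≤ ⊤)) n₀ n₁ n₂ hn₁ hn₂) := by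
  have hr : (2 : ℤ) ≤ (p : ℤ) + q + 2 := by lia
  let i₀ : EInt := ((q - (p + q + 2) + 2 : ℤ) : EInt)
  let i₃ : EInt := ((q + (p + q + 2) - 1 : ℤ) : EInt)
  have h₀ : i₀ ≤ ((q : ℤ) : EInt) := WithBotTop.coe_le_coe.2 (by lia)
  have h₃ : ((q + 1 : ℤ) : EInt) ≤ i₃ := WithBotTop.coe_le_coe.2 (by lia)
  have page := Y.spectralSequencePageXIso Abelian.SpectralObject.coreE₂CohomologicalNat
    ((p : ℤ) + q + 2) hr (p, q)
    i₀ ((q : ℤ) : EInt) ((q + 1 : ℤ) : EInt) i₃ rfl rfl rfl rfl n₀ n₁ n₂ hpq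
  have lower := Y.isoMapFourδ₁Toδ₀' ⊥ i₀ ((q : ℤ) : EInt) ((q + 1 : ℤ) : EInt) i₃ bot_le h₀ h h₃
    n₀ n₁ n₂ (Y.isZero₁_of_isFirstQuadrant _ _ _ (WithBotTop.coe_le_coe.2 (by lia)) _)
  have upper := Y.isoMapFourδ₄Toδ₃' ⊥ ((q : ℤ) : EInt) ((q + 1 : ℤ) : EInt) i₃ ⊤ bot_le h h₃ le_top
    n₀ n₁ n₂ (Y.isZero₂_of_isFirstQuadrant _ _ _ _ (WithBotTop.coe_lt_coe.2 (by lia)))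
  exact ⟨page ≪≫ lower.symm ≪≫ upper⟩

theorem convergesTo_E₂SpectralSequenceNat :
    ConvergesTo Y.E₂SpectralSequenceNat
      (fun n => (Y.H n).obj (mk₁ (homOfLE (bot_le : (⊥ : EInt) ≤ ⊤)))) := by
  intro n
  refine ⟨fun p => abutmentRange Y n (((n : ℤ) - p + 1 : ℤ) : EInt), ?_,
    abutmentRange_eq_top Y (by lia), abutmentRange_eq_bot Y n (by lia), ?_⟩
  · intro p p' h
    exact abutmentRange_mono Y n (WithBotTop.coe_le_coe.2 (by lia))
  · rintro p q rfl
    have hq : ((q : ℤ) : EInt) ≤ ((q + 1 : ℤ) : EInt) := WithBotTop.coe_le_coe.2 (by lia)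
    obtain ⟨e⟩ := nonempty_abutmentRange_quotient_equiv Y _ _ hq
      (((p + q : ℕ) : ℤ) - 1) ((p + q : ℕ) : ℤ) (((p + q : ℕ) : ℤ) + 1) (by lia) rfl
    obtain ⟨ε⟩ := nonempty_pageInfinity_iso Y p q
      (((p + q : ℕ) : ℤ) - 1) ((p + q : ℕ) : ℤ) (((p + q : ℕ) : ℤ) + 1) (by lia) rfl (by lia) hq
    have hp : ((p + q : ℕ) : ℤ) - p + 1 = q + 1 := by lia
    have hp' : ((p + q : ℕ) : ℤ) - (p + 1 : ℕ) + 1 = q := by lia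
    beta_reduce
    rw [hp, hp']
    exact ⟨e ≪≫ₗ ε.symm.toLinearEquiv⟩

theorem ConvergesTo.of_linearEquiv {E : E₂CohomologicalSpectralSequenceNat (ModuleCat.{u} K)}
    {H H' : ℕ → ModuleCat.{u} K} (h : ConvergesTo E H) (e : ∀ n, Nonempty (H n ≃ₗ[K] H' n)) :
    ConvergesTo E H' := by
  intro n
  obtain ⟨F, hF, htop, hbot, hE⟩ := h n
  obtain ⟨e⟩ := e n
  refine ⟨fun p => (F p).map e.toLinearMap, fun p p' hp => Submodule.map_mono (hF hp),
    by simp [htop], by simp [hbot], fun p q hpq => ?_⟩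
  obtain ⟨ε⟩ := hE p q hpq
  have hmap : ((F (p + 1)).submoduleOf (F p)).map (e.submoduleMap (F p)).toLinearMap =
      ((F (p + 1)).map e.toLinearMap).submoduleOf ((F p).map e.toLinearMap) := by
    ext x
    obtain ⟨x, rfl⟩ := (e.submoduleMap (F p)).surjective x
    rw [Submodule.mem_map_equiv, LinearEquiv.symm_apply_apply]
    exact (Function.Injective.mem_set_image e.injective).symm
  exact ⟨(Submodule.Quotient.equiv _ _ (e.submoduleMap (F p)) hmap).symm ≪≫ₗ ε⟩

end SpectralObject

section HomologicalFunctor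

open ComposableArrows Pretriangulated

variable {T 𝒜 ι : Type*} [Category T] [Preadditive T] [Limits.HasZeroObject T] [HasShift T ℤ]
  [∀ n : ℤ, (shiftFunctor T n).Additive] [Pretriangulated T] [Category 𝒜] [Abelian 𝒜]
  [Category ι]

/-- The spectral object of an abelian category obtained by applying a homological functor to a
spectral object of a triangulated category. -/
noncomputable def homologicalSpectralObject (F : T ⥤ 𝒜) [F.IsHomological] [F.ShiftSequence ℤ]
    (X : Triangulated.SpectralObject T ι) : Abelian.SpectralObject 𝒜 ι where
  H n := X.ω₁ ⋙ F.shift n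
  δ' n₀ n₁ h :=
    { app D := F.homologySequenceδ (X.ω₂.obj D) n₀ n₁ h
      naturality _ _ φ := F.homologySequenceδ_naturality _ _ (X.ω₂.map φ) n₀ n₁ h }
  exact₁' n₀ n₁ h D :=
    (F.homologySequence_exact₁ _ (X.ω₂_obj_distinguished D) n₀ n₁ h).exact_toComposableArrows
  exact₂' n D :=
    (F.homologySequence_exact₂ _ (X.ω₂_obj_distinguished D) n).exact_toComposableArrows
  exact₃' n₀ n₁ h D :=
    (F.homologySequence_exact₃ _ (X.ω₂_obj_distinguished D) n₀ n₁ h).exact_toComposableArrows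

variable (F : T ⥤ 𝒜) [F.IsHomological] [F.ShiftSequence ℤ] {X : Triangle T}

theorem isIso_shift_map_mor₁_of_isZero (hX : X ∈ distTriang T) (n₀ n₁ : ℤ) (h : n₀ + 1 = n₁)
    (h₀ : Limits.IsZero ((F.shift n₀).obj X.obj₃)) (h₁ : Limits.IsZero ((F.shift n₁).obj X.obj₃)) :
    IsIso ((F.shift n₁).map X.mor₁) := by
  have := (F.homologySequence_mono_shift_map_mor₁_iff X hX n₀ n₁ h).2 (h₀.eq_of_src _ _)
  have := (F.homologySequence_epi_shift_map_mor₁_iff X hX n₁).2 (h₁.eq_of_tgt _ _)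
  exact isIso_of_mono_of_epi _

theorem isIso_shift_map_mor₂_of_isZero (hX : X ∈ distTriang T) (n₀ n₁ : ℤ) (h : n₀ + 1 = n₁)
    (h₀ : Limits.IsZero ((F.shift n₀).obj X.obj₁)) (h₁ : Limits.IsZero ((F.shift n₁).obj X.obj₁)) :
    IsIso ((F.shift n₀).map X.mor₂) := by
  have := (F.homologySequence_mono_shift_map_mor₂_iff X hX n₀).2 (h₀.eq_of_src _ _)
  have := (F.homologySequence_epi_shift_map_mor₂_iff X hX n₀ n₁ h).2 (h₁.eq_of_tgt _ _)
  exact isIso_of_mono_of_epi _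

end HomologicalFunctor

section LinearCoyonedaShrink

open Pretriangulated

variable (K : Type*) [CommRing K] {T : Type*} [Category T] [Preadditive T] [Linear K T] (B : T)
  [∀ X : T, Small.{u} (B ⟶ X)]

/-- The functor `Hom(B, -)` with values in `u`-small `K`-modules. -/
noncomputable def linearCoyonedaShrink : T ⥤ ModuleCat.{u} K where
  obj X := ModuleCat.of K (Shrink.{u} (B ⟶ X))
  map {X Y} f := ModuleCat.ofHom ((Shrink.linearEquiv K (B ⟶ Y)).symm.toLinearMap ∘ₗ
    Linear.rightComp K B f ∘ₗ (Shrink.linearEquiv K (B ⟶ X)).toLinearMap)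
  map_id X := by ext x; simp
  map_comp f g := by ext x; simp

/-- The values of `linearCoyonedaShrink` are the modules of morphisms out of `B`. -/
noncomputable def linearCoyonedaShrinkEquiv (X : T) :
    (B ⟶ X) ≃ₗ[K] (linearCoyonedaShrink.{u} K B).obj X :=
  (Shrink.linearEquiv K (B ⟶ X)).symm

variable {K B} in
theorem linearCoyonedaShrink_map_apply {X Y : T} (f : X ⟶ Y) (x : B ⟶ X) :
    ((linearCoyonedaShrink.{u} K B).map f).hom (linearCoyonedaShrinkEquiv K B X x) =
      linearCoyonedaShrinkEquiv K B Y (x ≫ f) := by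
  change (Shrink.linearEquiv K (B ⟶ Y)).symm
    ((Shrink.linearEquiv K (B ⟶ X)) ((Shrink.linearEquiv K (B ⟶ X)).symm x) ≫ f) = _
  rw [LinearEquiv.apply_symm_apply]
  rfl

instance : (linearCoyonedaShrink.{u} K B).Additive where
  map_add {X Y f g} := by
    ext x
    obtain ⟨x, rfl⟩ := (linearCoyonedaShrinkEquiv K B X).surjective x
    rw [ModuleCat.hom_add, LinearMap.add_apply]
    simp only [linearCoyonedaShrink_map_apply, Preadditive.comp_add, map_add]

theorem isZero_linearCoyonedaShrink_obj {X : T} (h : ∀ f : B ⟶ X, f = 0) :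
    Limits.IsZero ((linearCoyonedaShrink.{u} K B).obj X) :=
  have : Subsingleton (B ⟶ X) := subsingleton_of_forall_eq 0 h
  have := (linearCoyonedaShrinkEquiv.{u} K B X).toEquiv.subsingleton_congr.1 this
  ModuleCat.isZero_of_subsingleton _

variable [Limits.HasZeroObject T] [HasShift T ℤ] [∀ n : ℤ, (shiftFunctor T n).Additive]
  [Pretriangulated T]

instance : (linearCoyonedaShrink.{u} K B).IsHomological where
  exact X hX := by
    rw [ShortComplex.moduleCat_exact_iff]
    intro x hx
    obtain ⟨x, rfl⟩ := (linearCoyonedaShrinkEquiv K B _).surjective x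
    obtain ⟨y, rfl⟩ := X.coyoneda_exact₂ hX x ((linearCoyonedaShrinkEquiv K B _).map_eq_zero_iff.1
      ((linearCoyonedaShrink_map_apply X.mor₂ x).symm.trans hx))
    exact ⟨linearCoyonedaShrinkEquiv K B _ y, linearCoyonedaShrink_map_apply X.mor₁ y⟩

noncomputable instance : (linearCoyonedaShrink.{u} K B).ShiftSequence ℤ :=
  Functor.ShiftSequence.tautological _ _

end LinearCoyonedaShrink

section Truncations

open Limits Pretriangulated DerivedCategory DerivedCategory.TStructure

universe w v u'

variable {C : Type u'} [Category.{v} C] [Abelian C] [HasDerivedCategory.{w} C]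

theorem nonempty_homology_truncGE_truncLT_iso (X : DerivedCategory C) (q : ℤ) :
    Nonempty ((homologyFunctor C q).obj ((t.truncGE q).obj ((t.truncLT (q + 1)).obj X)) ≅
      (homologyFunctor C q).obj X) := by
  have hGE (i : ℤ) (hi : i < q + 1) :
      IsZero ((homologyFunctor C i).obj ((t.truncGE (q + 1)).obj X)) :=
    isZero_of_isGE _ (q + 1) i hi (hX := inferInstanceAs (t.IsGE _ _))
  have hLT (i : ℤ) (hi : q - 1 < i) :
      IsZero ((homologyFunctor C i).obj ((t.truncLT q).obj ((t.truncLT (q + 1)).obj X))) :=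
    isZero_of_isLE _ (q - 1) i hi (hX := inferInstanceAs (t.IsLE _ _))
  have : IsIso ((homologyFunctor C q).map ((t.truncLTι (q + 1)).app X)) :=
    isIso_shift_map_mor₁_of_isZero (homologyFunctor C 0)
      (t.triangleLTGE_distinguished (q + 1) X) (q - 1) q (by lia)
      (hGE _ (by lia)) (hGE _ (by lia))
  have : IsIso ((homologyFunctor C q).map ((t.truncGEπ q).app ((t.truncLT (q + 1)).obj X))) :=
    isIso_shift_map_mor₂_of_isZero (homologyFunctor C 0)
      (t.triangleLTGE_distinguished q ((t.truncLT (q + 1)).obj X)) q (q + 1) rfl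
      (hLT _ (by lia)) (hLT _ (by lia))
  exact ⟨(asIso ((homologyFunctor C q).map ((t.truncGEπ q).app _))).symm ≪≫
    asIso ((homologyFunctor C q).map ((t.truncLTι (q + 1)).app X))⟩

/-- An object of the heart placed in degree `q` is its own homology in degree `q`. -/
noncomputable def homologySingleIso (V : C) (q : ℤ) :
    (homologyFunctor C q).obj ((singleFunctor C q).obj V) ≅ V :=
  (homologyFunctor C q).mapIso ((singleFunctorIsoCompQ C q).app V) ≪≫
    (homologyFunctorFactors C q).app _ ≪≫
    (HomologicalComplex.homologyFunctorSingleIso C _ q).app V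

theorem nonempty_truncGE_truncLT_iso_single (X : DerivedCategory C) (q : ℤ) :
    Nonempty ((t.truncGE q).obj ((t.truncLT (q + 1)).obj X) ≅
      (singleFunctor C q).obj ((homologyFunctor C q).obj X)) := by
  have : t.IsLE ((t.truncLT (q + 1)).obj X) q := inferInstance
  have : IsLE ((t.truncGE q).obj ((t.truncLT (q + 1)).obj X)) q := inferInstance
  have : IsGE ((t.truncGE q).obj ((t.truncLT (q + 1)).obj X)) q := inferInstanceAs (t.IsGE _ _)
  obtain ⟨V, ⟨e⟩⟩ := exists_iso_singleFunctor_obj_of_isGE_of_isLE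
    ((t.truncGE q).obj ((t.truncLT (q + 1)).obj X)) q
  obtain ⟨e'⟩ := nonempty_homology_truncGE_truncLT_iso X q
  exact ⟨e ≪≫ (singleFunctor C q).mapIso
    ((homologySingleIso V q).symm ≪≫ (homologyFunctor C q).mapIso e.symm ≪≫ e')⟩

theorem surjective_Q_map_of_isKProjective (P L : CochainComplex C ℤ) [P.IsKProjective] :
    Function.Surjective (Q.map : (P ⟶ L) → _) := by
  intro f
  obtain ⟨g, hg⟩ := (CochainComplex.IsKProjective.Qh_map_bijective P
    ((HomotopyCategory.quotient _ _).obj L)).surjective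
    ((quotientCompQhIso C).hom.app _ ≫ f ≫ (quotientCompQhIso C).inv.app _)
  obtain ⟨g, rfl⟩ := (HomotopyCategory.quotient _ _).map_surjective g
  refine ⟨g, ?_⟩
  rw [← NatIso.naturality_1 (quotientCompQhIso C) g, Functor.comp_map, hg]
  simp only [Category.assoc, Iso.inv_hom_id_app, Iso.inv_hom_id_app_assoc]
  exact Category.comp_id f

theorem small_hom_singleFunctor [EnoughProjectives C] (B : C) (X : DerivedCategory C) :
    Small.{v} ((singleFunctor C 0).obj B ⟶ X) := by
  let P := ProjectiveResolution.of B
  let eB : Q.obj P.cochainComplex ≅ (singleFunctor C 0).obj B :=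
    asIso (Q.map P.π') ≪≫ ((singleFunctorIsoCompQ C 0).app B).symm
  have : Small.{v} (Q.obj P.cochainComplex ⟶ Q.obj (Q.objPreimage X)) :=
    small_of_surjective (surjective_Q_map_of_isKProjective P.cochainComplex (Q.objPreimage X))
  exact small_map (Iso.homCongr eB (Q.objObjPreimageIso X)).symm

variable (K : Type*) [CommRing K] [Linear K C] [EnoughProjectives C] (B : C)
  (X : DerivedCategory C)

attribute [local instance] small_hom_singleFunctor

/-- The spectral object with terms `Hom(B, τ_{[i, j)} X[n])` in the derived category; its spectral
sequence is the hypercohomology spectral sequence of `X` with respect to `Hom(B, -)`. -/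
noncomputable def homSpectralObject : Abelian.SpectralObject (ModuleCat.{v} K) EInt :=
  homologicalSpectralObject (linearCoyonedaShrink K ((singleFunctor C 0).obj B))
    (t.spectralObject X)

/-- The abutment of `homSpectralObject` is `Hom(B, X[n])`. -/
noncomputable def homSpectralObjectAbutmentEquiv (n : ℤ) :
    ((singleFunctor C 0).obj B ⟶ X⟦n⟧) ≃ₗ[K] ((homSpectralObject K B X).H n).obj
      (ComposableArrows.mk₁ (homOfLE (bot_le : (⊥ : EInt) ≤ ⊤))) :=
  linearCoyonedaShrinkEquiv K ((singleFunctor C 0).obj B) (X⟦n⟧)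

instance [X.IsGE 0] : (homSpectralObject K B X).IsFirstQuadrant where
  isZero₁ i j _ hj n := by
    have hLT := t.isZero_eTruncLT_obj_obj X 0 j hj
    exact isZero_linearCoyonedaShrink_obj _ _ fun f =>
      ((shiftFunctor _ n).map_isZero ((t.eTruncGE.obj i).map_isZero hLT)).eq_of_tgt _ _
  isZero₂ i j _ n hi := by
    have hni : ((n + 1 : ℤ) : EInt) ≤ i := by
      induction i using WithBotTop.rec with
      | bot => simp at hi
      | coe i => exact WithBotTop.coe_le_coe.2 (WithBotTop.coe_lt_coe.1 hi)
      | top => simp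
    have hGE := t.isGE_eTruncGE_obj_obj (n + 1) i hni ((t.eTruncLT.obj j).obj X)
    have hGE_shift := t.isGE_shift ((t.eTruncGE.obj i).obj ((t.eTruncLT.obj j).obj X)) (n + 1) n 1
    have hLE : t.IsLE ((singleFunctor C 0).obj B) 0 :=
      inferInstanceAs (IsLE ((singleFunctor C 0).obj B) 0)
    exact isZero_linearCoyonedaShrink_obj _ _ fun f =>
      t.zero_of_isLE_of_isGE f 0 1 (by lia) hLE hGE_shift

/-- Shifting the object of the heart in degree `q` by `p + q` places it in degree `-p`. -/
noncomputable def singleFunctorShiftAddIso (V : C) (p q : ℤ) :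
    ((singleFunctor C q).obj V)⟦p + q⟧ ≅ ((singleFunctor C 0).obj V)⟦p⟧ :=
  (shiftFunctorAdd' (DerivedCategory C) q p (p + q) (add_comm _ _)).app _ ≪≫
    (shiftFunctor _ p).mapIso (((singleFunctors C).shiftIso q 0 q (add_zero _)).app V)

theorem nonempty_homSpectralObject_page_two [X.IsGE 0] [HasExt.{v} C] (p q : ℕ) :
    Nonempty (((homSpectralObject K B X).E₂SpectralSequenceNat.page 2 le_rfl).X (p, q) ≅
      ModuleCat.of K (Abelian.Ext B ((homologyFunctor C (q : ℤ)).obj X) p)) := by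
  have firstPage := (homSpectralObject K B X).spectralSequenceFirstPageXIso
    Abelian.SpectralObject.coreE₂CohomologicalNat (p, q) ((q : ℤ) : EInt)
    ((q + 1 : ℤ) : EInt) rfl rfl ((p : ℤ) + q) rfl
  obtain ⟨trunc⟩ := nonempty_truncGE_truncLT_iso_single X q
  exact ⟨firstPage ≪≫ (linearCoyonedaShrink K ((singleFunctor C 0).obj B)).mapIso
      ((shiftFunctor _ ((p : ℤ) + q)).mapIso trunc ≪≫ singleFunctorShiftAddIso _ p q) ≪≫
    ((linearCoyonedaShrinkEquiv K ((singleFunctor C 0).obj B) _).symm ≪≫ₗ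
      (Abelian.Ext.homLinearEquiv (R := K) (X := B) (n := p)).symm).toModuleIso⟩

end Truncations

section MapExtend

open HomologicalComplex Limits

variable {ι ι' C D : Type*} {c : ComplexShape ι} {c' : ComplexShape ι'} [Category C] [Category D]
  [HasZeroMorphisms C] [HasZeroMorphisms D] [HasZeroObject C] [HasZeroObject D] (F : C ⥤ D)
  [F.PreservesZeroMorphisms] (L : HomologicalComplex C c)

/-- The components of `mapExtendIso`. -/
noncomputable def mapExtendXIso :
    ∀ i : Option ι, F.obj (extend.X L i) ≅ extend.X ((F.mapHomologicalComplex c).obj L) i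
  | none => F.mapZeroObject
  | some _ => Iso.refl _

theorem mapExtendXIso_hom_comp_d (i j : Option ι) :
    (mapExtendXIso F L i).hom ≫ extend.d ((F.mapHomologicalComplex c).obj L) i j =
      F.map (extend.d L i j) ≫ (mapExtendXIso F L j).hom := by
  match i, j with
  | none, _ => exact (F.map_isZero (isZero_zero C)).eq_of_src _ _
  | some _, none => exact (isZero_zero D).eq_of_tgt _ _
  | some _, some _ => exact (Category.id_comp _).trans (Category.comp_id _).symm

/-- Applying a functor to the terms of a complex commutes with extension by zero. -/
noncomputable def mapExtendIso (e : c.Embedding c') :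
    (F.mapHomologicalComplex c').obj (L.extend e) ≅ ((F.mapHomologicalComplex c).obj L).extend e :=
  Hom.isoOfComponents (fun i => mapExtendXIso F L (e.r i)) fun i j _ =>
    mapExtendXIso_hom_comp_d F L (e.r i) (e.r j)

end MapExtend

section HomToKInjective

open Limits CochainComplex HomComplex DerivedCategory

universe w w' v u'

variable {C : Type u'} [Category.{v} C] [Abelian C] (K : Type*) [CommRing K] [Linear K C]

variable {K} in
theorem equivHomShift_symm_smul {L M : CochainComplex C ℤ} {n : ℤ} (r : K) (z : Cocycle L M n) :
    Cocycle.equivHomShift.symm (r • z) = r • Cocycle.equivHomShift.symm z := by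
  obtain ⟨f, rfl⟩ := Cocycle.equivHomShift.surjective z
  rw [AddEquiv.symm_apply_apply]
  apply Cocycle.equivHomShift.injective
  rw [AddEquiv.apply_symm_apply]
  ext p q hpq
  subst hpq
  simp only [Cocycle.equivHomShift_apply, Cocycle.coe_smul, Cocycle.rightUnshift_coe,
    Cocycle.ofHom_coe, Cochain.smul_v, Cochain.rightUnshift_v _ _ _ _ _ _ _ (add_zero p),
    shiftFunctor_obj_X', Cochain.ofHom_v, shiftFunctorObjXIso, HomologicalComplex.XIsoOfEq_rfl,
    Iso.refl_hom, HomologicalComplex.smul_f_apply, Category.comp_id]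
  exact congrArg (r • ·) (Category.comp_id _)

variable (A : C) (L : CochainComplex C ℤ) (n : ℤ)

/-- The cocycles of degree `n` of the complex `Hom(A, L)`. -/
abbrev homCocycles : Submodule K (A ⟶ L.X n) :=
  LinearMap.ker (Linear.rightComp K A (L.d n (n + 1)))

/-- A cocycle of `Hom(A, L)` as a cocycle of the complex of morphisms from `A`, placed in degree
`0`, to `L`. -/
noncomputable def cocycleOfHom :
    homCocycles K A L n →ₗ[K] Cocycle ((CochainComplex.singleFunctor C 0).obj A) L n where
  toFun f := Cocycle.fromSingleMk f.1 (zero_add n) (n + 1) rfl (LinearMap.mem_ker.1 f.2)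
  map_add' f g := Subtype.ext (Cochain.fromSingleMk_add f.1 g.1 (zero_add n))
  map_smul' r f := by
    refine Subtype.ext ((Cochain.fromSingleEquiv (zero_add n)).injective ?_)
    change Cochain.fromSingleEquiv (zero_add n) (Cochain.fromSingleMk (r • f.1) (zero_add n)) =
      Cochain.fromSingleEquiv (zero_add n) (r • Cochain.fromSingleMk f.1 (zero_add n))
    simp only [Cochain.fromSingleEquiv_fromSingleMk]
    simp only [Cochain.fromSingleEquiv, AddEquiv.coe_mk, Equiv.coe_fn_mk, Cochain.smul_v,
      Cochain.fromSingleMk_v]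
    exact ((Linear.comp_smul _ _ _ _ _ _).trans (congrArg _ (Iso.inv_hom_id_assoc _ _))).symm

variable [HasDerivedCategory.{w} C]

/-- The morphism `A ⟶ L[n]` in the derived category represented by a cocycle of `Hom(A, L)`. -/
noncomputable def derivedHomOfCocycle :
    homCocycles K A L n →ₗ[K] ((DerivedCategory.singleFunctor C 0).obj A ⟶ (Q.obj L)⟦n⟧) where
  toFun f := (singleFunctorIsoCompQ C 0).hom.app A ≫
    Q.map (Cocycle.equivHomShift.symm (cocycleOfHom K A L n f)) ≫ (Q.commShiftIso n).hom.app L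
  map_add' f g := by
    rw [← Preadditive.comp_add, ← Preadditive.add_comp, ← Functor.map_add, ← map_add, ← map_add]
  map_smul' r f := by
    rw [RingHom.id_apply, ← Linear.comp_smul, ← Linear.smul_comp, ← Functor.map_smul,
      ← equivHomShift_symm_smul, ← map_smul]

/-- An object of the heart as the image of an object of the homotopy category. -/
noncomputable def singleFunctorIsoQh : (DerivedCategory.singleFunctor C 0).obj A ≅
    Qh.obj ((HomotopyCategory.quotient _ _).obj ((CochainComplex.singleFunctor C 0).obj A)) :=
  (singleFunctorIsoCompQ C 0).app A ≪≫ (quotientCompQhIso C).symm.app _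

/-- A shifted complex in the derived category as the image of an object of the homotopy
category. -/
noncomputable def shiftIsoQh :
    (Q.obj L)⟦n⟧ ≅ Qh.obj ((HomotopyCategory.quotient _ _).obj (L⟦n⟧)) :=
  (Q.commShiftIso n).symm.app L ≪≫ (quotientCompQhIso C).symm.app _

theorem derivedHomOfCocycle_eq (f : homCocycles K A L n) :
    derivedHomOfCocycle K A L n f = (singleFunctorIsoQh A).hom ≫
      Qh.map (CohomologyClass.toHom (.mk (cocycleOfHom K A L n f))) ≫ (shiftIsoQh L n).inv := by
  change _ ≫ _ ≫ _ = _
  rw [← NatIso.naturality_1 (quotientCompQhIso C)]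
  simp only [Category.assoc, shiftIsoQh, singleFunctorIsoQh, Iso.trans_hom]
  rfl

variable [CochainComplex.IsKInjective L]

theorem derivedHomOfCocycle_surjective : Function.Surjective (derivedHomOfCocycle K A L n) := by
  intro x
  obtain ⟨y, hy⟩ := (CochainComplex.IsKInjective.Qh_map_bijective _ (L⟦n⟧)).surjective
    ((singleFunctorIsoQh A).inv ≫ x ≫ (shiftIsoQh L n).hom)
  obtain ⟨y, rfl⟩ := (CohomologyClass.toHom_bijective _ _ _).surjective y
  obtain ⟨y, rfl⟩ := y.mk_surjective
  obtain ⟨f, hf, rfl⟩ := Cocycle.fromSingleMk_surjective y n (zero_add n) (n + 1) rfl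
  refine ⟨⟨f, hf⟩, ?_⟩
  rw [derivedHomOfCocycle_eq, ← Iso.eq_inv_comp, Iso.comp_inv_eq, Category.assoc]
  exact hy

theorem derivedHomOfCocycle_eq_zero_iff (f : homCocycles K A L n) :
    derivedHomOfCocycle K A L n f = 0 ↔ ∃ g : A ⟶ L.X (n - 1), g ≫ L.d (n - 1) n = f.1 := by
  rw [derivedHomOfCocycle_eq, Preadditive.IsIso.comp_left_eq_zero,
    Preadditive.IsIso.comp_right_eq_zero, ← Qh.map_zero,
    (CochainComplex.IsKInjective.Qh_map_bijective _ (L⟦n⟧)).injective.eq_iff,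
    CohomologyClass.toHom_mk_eq_zero_iff]
  exact Cocycle.fromSingleMk_mem_coboundaries_iff f.1 (zero_add n) (n + 1) rfl f.2 (n - 1)
    (by lia)

theorem nonempty_derivedHom_linearEquiv {C' : Type*} [Category C'] [Abelian C']
    [HasDerivedCategory.{w'} C'] [Linear K C'] (A' : C') (L' : CochainComplex C' ℤ)
    [CochainComplex.IsKInjective L'] (e : ∀ i, (A ⟶ L.X i) ≃ₗ[K] (A' ⟶ L'.X i))
    (he : ∀ i j (f : A ⟶ L.X i), e j (f ≫ L.d i j) = e i f ≫ L'.d i j) :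
    Nonempty (((DerivedCategory.singleFunctor C 0).obj A ⟶ (Q.obj L)⟦n⟧) ≃ₗ[K]
      ((DerivedCategory.singleFunctor C' 0).obj A' ⟶ (Q.obj L')⟦n⟧)) := by
  have hcocycles : (homCocycles K A L n).map (e n).toLinearMap = homCocycles K A' L' n := by
    ext x
    obtain ⟨x, rfl⟩ := (e n).surjective x
    rw [Submodule.mem_map_equiv, LinearEquiv.symm_apply_apply]
    change x ≫ L.d n (n + 1) = 0 ↔ e n x ≫ L'.d n (n + 1) = 0
    rw [← he, map_eq_zero_iff _ (e (n + 1)).injective]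
  let eZ : homCocycles K A L n ≃ₗ[K] homCocycles K A' L' n := (e n).ofSubmodules _ _ hcocycles
  have hker : (LinearMap.ker (derivedHomOfCocycle K A L n)).map eZ.toLinearMap =
      LinearMap.ker (derivedHomOfCocycle K A' L' n) := by
    ext x
    obtain ⟨x, rfl⟩ := eZ.surjective x
    rw [Submodule.mem_map_equiv, LinearEquiv.symm_apply_apply, LinearMap.mem_ker,
      LinearMap.mem_ker, derivedHomOfCocycle_eq_zero_iff, derivedHomOfCocycle_eq_zero_iff,
      (e (n - 1)).surjective.exists]
    refine exists_congr fun g => ?_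
    change _ ↔ e (n - 1) g ≫ L'.d (n - 1) n = e n x.1
    rw [← he, (e n).injective.eq_iff]
  exact ⟨((derivedHomOfCocycle K A L n).quotKerEquivOfSurjective
      (derivedHomOfCocycle_surjective K A L n)).symm ≪≫ₗ
    Submodule.Quotient.equiv _ _ eZ hker ≪≫ₗ
    (derivedHomOfCocycle K A' L' n).quotKerEquivOfSurjective
      (derivedHomOfCocycle_surjective K A' L' n)⟩

end HomToKInjective

section Grothendieck

open Limits DerivedCategory ComplexShape

universe w v u'

variable {C : Type u'} [Category.{v} C] [Abelian C]

/-- `Ext` as shifted morphisms in the derived category to an injective resolution. -/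
noncomputable def extLinearEquivHomResolution (K : Type*) [CommRing K] [Linear K C]
    [HasDerivedCategory.{w} C] [HasExt.{v} C] (A : C) (n : ℕ) {B : C} (R : InjectiveResolution B) :
    Abelian.Ext A B n ≃ₗ[K] ((singleFunctor C 0).obj A ⟶ (Q.obj R.cochainComplex)⟦(n : ℤ)⟧) :=
  Abelian.Ext.homLinearEquiv ≪≫ₗ Linear.homCongr K (Iso.refl _)
    ((shiftFunctor _ (n : ℤ)).mapIso
      ((singleFunctorIsoCompQ C 0).app B ≪≫ asIso (Q.map R.ι')))

/-- The homology of `G` applied to an injective resolution is given by the derived functors. -/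
noncomputable def homologyMapResolutionIso {D : Type*} [Category D] [Abelian D]
    [HasDerivedCategory.{w} D] [EnoughInjectives C] (G : C ⥤ D) [G.Additive] {M : C}
    (R : InjectiveResolution M) (q : ℕ) :
    (homologyFunctor D (q : ℤ)).obj
        (Q.obj ((G.mapHomologicalComplex (up ℤ)).obj R.cochainComplex)) ≅
      (G.rightDerived q).obj M :=
  (homologyFunctorFactors D (q : ℤ)).app _ ≪≫
    (HomologicalComplex.homologyFunctor D (up ℤ) q).mapIso
      (mapExtendIso G R.cocomplex embeddingUpNat) ≪≫
    HomologicalComplex.extendHomologyIso _ embeddingUpNat rfl ≪≫ (R.isoRightDerivedObj G q).symm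

theorem isKInjective_map_cochainComplex {D : Type*} [Category D] [Abelian D] (G : C ⥤ D)
    [G.Additive] [G.PreservesInjectiveObjects] {M : C} (R : InjectiveResolution M) :
    CochainComplex.IsKInjective ((G.mapHomologicalComplex (up ℤ)).obj R.cochainComplex) := by
  have (i : ℤ) : Injective (((G.mapHomologicalComplex (up ℤ)).obj R.cochainComplex).X i) :=
    inferInstanceAs (Injective (G.obj (R.cochainComplex.X i)))
  exact CochainComplex.isKInjective_of_injective _ 0

theorem exists_grothendieck_spectralSequence {K : Type u} [Field K]
    {C : Type*} [Category.{u} C] [Abelian C] [Linear K C] [EnoughInjectives C] [HasExt.{u} C]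
    {D : Type*} [Category.{u} D] [Abelian D] [Linear K D] [EnoughProjectives D] [HasExt.{u} D]
    (G : C ⥤ D) [G.Additive] [G.PreservesInjectiveObjects] (A : C) (B : D)
    (e : ∀ N : C, (B ⟶ G.obj N) ≃ₗ[K] (A ⟶ N))
    (he : ∀ {N N' : C} (g : N ⟶ N') (f : B ⟶ G.obj N), e N' (f ≫ G.map g) = e N f ≫ g) (M : C) :
    ∃ E : E₂CohomologicalSpectralSequenceNat (ModuleCat.{u} K),
      (∀ p q : ℕ, Nonempty ((E.page 2 le_rfl).X (p, q) ≅
        ModuleCat.of K (Abelian.Ext B ((G.rightDerived q).obj M) p))) ∧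
      ConvergesTo E (fun n => ModuleCat.of K (Abelian.Ext A M n)) := by
  let := HasDerivedCategory.standard C
  let := HasDerivedCategory.standard D
  let R := InjectiveResolution.of M
  let L := (G.mapHomologicalComplex (up ℤ)).obj R.cochainComplex
  have : CochainComplex.IsKInjective L := isKInjective_map_cochainComplex G R
  have : (Q.obj L).IsGE 0 := inferInstance
  refine ⟨(homSpectralObject K B (Q.obj L)).E₂SpectralSequenceNat, fun p q => ?_,
    (convergesTo_E₂SpectralSequenceNat _).of_linearEquiv fun n => ?_⟩
  · obtain ⟨pageTwo⟩ := nonempty_homSpectralObject_page_two K B (Q.obj L) p q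
    exact ⟨pageTwo ≪≫ (Abelian.Ext.homLinearEquiv ≪≫ₗ Linear.homCongr K (Iso.refl _)
      ((shiftFunctor _ (p : ℤ)).mapIso
        ((singleFunctor D 0).mapIso (homologyMapResolutionIso G R q))) ≪≫ₗ
      Abelian.Ext.homLinearEquiv.symm).toModuleIso⟩
  · obtain ⟨derivedHom⟩ := nonempty_derivedHom_linearEquiv K B L n A R.cochainComplex
      (fun i => e (R.cochainComplex.X i)) (fun i j => he (R.cochainComplex.d i j))
    exact ⟨(homSpectralObjectAbutmentEquiv K B (Q.obj L) n).symm ≪≫ₗ derivedHom ≪≫ₗ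
      (extLinearEquivHomResolution K A n R).symm⟩

end Grothendieck

/-! ### Commutative von Neumann regular rings -/

section VonNeumannRegular

/-- A finitely generated ideal is idempotent, since `x = (x y) x`, and hence a direct summand. -/
theorem flat_of_forall_exists_mul_mul_eq_self {R : Type*} [CommRing R]
    (hR : ∀ x : R, ∃ y, x * y * x = x) (M : Type*) [AddCommGroup M] [Module R M] :
    Module.Flat R M := by
  rw [Module.Flat.iff_rTensor_injective]
  intro I hI
  have hI_idem : IsIdempotentElem I := le_antisymm Ideal.mul_le_right fun x hx => by
    obtain ⟨y, hy⟩ := hR x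
    rw [← hy]
    exact Ideal.mul_mem_mul (I.mul_mem_right y hx) hx
  obtain ⟨e, he, rfl⟩ := (Ideal.isIdempotentElem_iff_of_fg I hI).1 hI_idem
  let retraction : R →ₗ[R] Ideal.span {e} := (LinearMap.mulRight R e).codRestrict _ fun x =>
    Ideal.mul_mem_left _ x (Ideal.mem_span_singleton_self e)
  have h_retract : retraction ∘ₗ (Ideal.span {e}).subtype = LinearMap.id := by
    ext ⟨x, hx⟩
    obtain ⟨a, rfl⟩ := Ideal.mem_span_singleton'.1 hx
    exact (mul_assoc a e e).trans (congrArg (a * ·) he)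
  refine Function.LeftInverse.injective (g := retraction.rTensor M) fun z => ?_
  rw [← LinearMap.comp_apply, ← LinearMap.rTensor_comp, h_retract, LinearMap.rTensor_id_apply]

theorem exists_idem_mul_add_mul_mul_eq_self {R : Type*} [CommRing R] {w x x' y y' : R}
    (hw : w * w = w) (hx : x * y * x = x) (hx' : x' * y' * x' = x') :
    ∃ z, (w * x + (1 - w) * x') * z * (w * x + (1 - w) * x') = w * x + (1 - w) * x' :=
  ⟨w * y + (1 - w) * y', by grind⟩

/-- On the summand cut out by an idempotent `e`, adding `c • e` amounts to adding the scalar `c`. -/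
theorem monoidAlgebra_exists_mul_mul_eq_self {K E : Type*} [CommRing K] [CommMonoid E]
    (hK : ∀ k : K, ∃ y, k * y * k = k) (hE : ∀ e : E, e * e = e) (x : MonoidAlgebra K E) :
    ∃ y, x * y * x = x := by
  suffices h : ∀ k : K, ∃ y, (x + algebraMap K _ k) * y * (x + algebraMap K _ k) =
      x + algebraMap K _ k by simpa using h 0
  induction x using MonoidAlgebra.induction with
  | zero =>
    intro k
    obtain ⟨y, hy⟩ := hK k
    exact ⟨algebraMap K _ y, by rw [zero_add, ← map_mul, ← map_mul, hy]⟩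
  | single_add e c x _ _ ih =>
    intro k
    obtain ⟨y, hy⟩ := ih (c + k)
    obtain ⟨z, hz⟩ := ih k
    have he : MonoidAlgebra.of K E e * MonoidAlgebra.of K E e = MonoidAlgebra.of K E e := by
      rw [← map_mul, hE]
    have h_single : MonoidAlgebra.single e c = algebraMap K _ c * MonoidAlgebra.of K E e := by
      rw [← Algebra.smul_def, MonoidAlgebra.of_apply, MonoidAlgebra.smul_single, smul_eq_mul,
        mul_one]
    have h_split : MonoidAlgebra.single e c + x + algebraMap K _ k =
        MonoidAlgebra.of K E e * (x + algebraMap K _ (c + k)) +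
          (1 - MonoidAlgebra.of K E e) * (x + algebraMap K _ k) := by
      rw [h_single, map_add]
      ring
    rw [h_split]
    exact exists_idem_mul_add_mul_mul_eq_self he hy hz

end VonNeumannRegular

/-! ### Inverse monoids and crossed products -/

namespace InverseMonoid

variable {S : Type*} [InverseMonoid S]

variable (S) in
/-- The submonoid `E(S)` of idempotents of an inverse monoid `S`. -/
def idemSubmonoid : Submonoid S where
  carrier := {e | e * e = e}
  one_mem' := mul_one 1
  mul_mem' := idem_mul

instance : CommMonoid (idemSubmonoid S) where
  mul_comm e f := Subtype.ext (idem_comm e.2 f.2)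

theorem conj_mul_of_idem {e : S} (he : e * e = e) (s : S) : s * e * s⁻¹ * s = s * e := by
  rw [mul_assoc, mul_assoc, idem_comm he (inv_mul_idem s), ← mul_assoc, ← mul_assoc, mul_inv_mul]

theorem conj_idem {e : S} (he : e * e = e) (s : S) :
    (s * e * s⁻¹) * (s * e * s⁻¹) = s * e * s⁻¹ :=
  (s • (show Idem S from ⟨e, he⟩)).2

variable (S) in
/-- The idempotent `1` of `S`, whose class generates the trivial module `KE(S)`. -/
def idemOne : Idem S := ⟨1, mul_one 1⟩

theorem coe_smul_idemOne (s : S) : (s • idemOne S).1 = s * s⁻¹ := by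
  change s * 1 * s⁻¹ = _
  rw [mul_one]

theorem coe_smul_idemOne_self (e : Idem S) : e.1 • idemOne S = e :=
  Subtype.ext (by rw [coe_smul_idemOne, inv_of_idem e.2, e.2])

end InverseMonoid

namespace UnitalAction

open InverseMonoid

section CrossedProduct

variable {K S A : Type*} [CommRing K] [InverseMonoid S] [Ring A] [Algebra K A]
variable (θ : UnitalAction K S A)

theorem act_of_idem {e : S} (he : e * e = e) (a : A) : θ.act e a = θ.unit e * a := by
  have h := θ.act_act_inv e a
  rwa [inv_of_idem he, ← act_comp, he] at h

theorem unit_idem_mul {e : S} (he : e * e = e) (t : S) :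
    θ.unit (e * t) = θ.unit e * θ.unit t := by
  rw [← act_unit, act_comp, act_of_idem θ he, act_unit]

theorem incl_unit_mul_delta (s : S) : θ.incl (θ.unit s) * θ.delta s = θ.delta s := by
  have h := θ.incl_unit_mul s 1
  rwa [mul_one, _root_.map_one, one_mul] at h

theorem delta_mul_incl_unit_inv (s : S) : θ.delta s * θ.incl (θ.unit s⁻¹) = θ.delta s := by
  rw [delta_mul_incl, ← θ.act_unit s⁻¹, act_act_inv, mul_one, incl_unit_mul_delta]

theorem coe_inclL_mul_deltaL (s : S) (a : A) :
    ((θ.inclL a * θ.deltaL s : θ.skewSum) : S →₀ A) = Finsupp.single s (a * θ.unit s) := by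
  change θ.mulAux (Finsupp.single 1 a) (Finsupp.single s (θ.unit s)) = _
  rw [mulAux_single, act_one, one_mul]

theorem quot_eq_iff (x y : θ.skewSum) : θ.quot x = θ.quot y ↔ x - y ∈ θ.ideal :=
  (RingCon.eq _).trans (TwoSidedIdeal.rel_iff _ _ _)

theorem quot_surjective : Function.Surjective θ.quot := Quotient.mk_surjective

theorem delta_of_idem {e : S} (he : e * e = e) : θ.delta e = θ.incl (θ.unit e) := by
  have h : θ.quot (θ.inclL (θ.unit e) * θ.deltaL e) =
      θ.quot (θ.inclL (θ.unit e) * θ.deltaL 1) := by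
    rw [quot_eq_iff]
    refine TwoSidedIdeal.subset_span ⟨e, 1, θ.unit e, ⟨e, he, (mul_one e).symm⟩, θ.unit_idem e, ?_⟩
    rw [AddSubgroupClass.coe_sub, coe_inclL_mul_deltaL, coe_inclL_mul_deltaL, θ.unit_idem,
      θ.unit_one, mul_one]
  rw [_root_.map_mul, _root_.map_mul, _root_.map_one, _root_.map_one, mul_one] at h
  exact (θ.incl_unit_mul_delta e).symm.trans h

theorem incl_mul_delta_of_idem {e : S} (he : e * e = e) (a : A) :
    θ.incl a * θ.delta e = θ.delta e * θ.incl a := by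
  rw [delta_of_idem θ he, ← _root_.map_mul, ← _root_.map_mul, unit_central]

theorem eq_sum_inclL_mul_deltaL (f : θ.skewSum) :
    f = ∑ s ∈ f.1.support, θ.inclL (f.1 s) * θ.deltaL s := by
  apply Subtype.ext
  rw [AddSubmonoidClass.coe_finsetSum]
  conv_lhs => rw [← Finsupp.sum_single f.1, Finsupp.sum]
  refine Finset.sum_congr rfl fun s _ => ?_
  rw [coe_inclL_mul_deltaL, ← unit_central, f.2 s]

theorem crossedProduct_induction {P : θ.CrossedProduct → Prop} (x : θ.CrossedProduct)
    (zero : P 0) (add : ∀ x y, P x → P y → P (x + y))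
    (incl_mul_delta : ∀ a s, P (θ.incl a * θ.delta s)) : P x := by
  obtain ⟨x, rfl⟩ := θ.quot_surjective x
  rw [θ.eq_sum_inclL_mul_deltaL x, _root_.map_sum]
  refine Finset.sum_induction _ P add zero fun s _ => ?_
  rw [_root_.map_mul]
  exact incl_mul_delta _ _

end CrossedProduct

section Lift

variable {K S A : Type*} [CommRing K] [InverseMonoid S] [Ring A] [Algebra K A]
variable (θ : UnitalAction K S A)
variable {B : Type*} [Ring B] [Algebra K B] (ι : A →ₐ[K] B) (D : S →* B)
  (h : ∀ s a, D s * ι a = ι (θ.act s a) * D s)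

/-- The `K`-linear extension of `a δ_s ↦ ι(a) D(s)`, on all finitely supported functions. -/
noncomputable def liftFinsupp : (S →₀ A) →ₗ[K] B :=
  Finsupp.lsum K fun s => LinearMap.mulRight K (D s) ∘ₗ ι.toLinearMap

theorem liftFinsupp_single (s : S) (a : A) :
    liftFinsupp ι D (Finsupp.single s a) = ι a * D s := by
  rw [liftFinsupp, Finsupp.lsum_single]
  rfl

include h in
theorem liftFinsupp_mulAux (f g : S →₀ A) :
    liftFinsupp ι D (θ.mulAux f g) = liftFinsupp ι D f * liftFinsupp ι D g := by
  induction f using Finsupp.induction_linear with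
  | zero => simp
  | add f f' hf hf' => simp only [_root_.map_add, LinearMap.add_apply, hf, hf', add_mul]
  | single s a =>
    induction g using Finsupp.induction_linear with
    | zero => simp
    | add g g' hg hg' => simp only [_root_.map_add, hg, hg', mul_add]
    | single t b =>
      rw [mulAux_single, liftFinsupp_single, liftFinsupp_single, liftFinsupp_single,
        _root_.map_mul, _root_.map_mul, mul_assoc, mul_assoc, ← mul_assoc (D s), h, mul_assoc]

/-- The homomorphism `L(A, θ, S) → B`, `a δ_s ↦ ι(a) D(s)`, given by a covariant pair `(ι, D)`:
homomorphisms of `A` and `S` to `B` with `D(s) ι(a) = ι(θ_s(1_{s⁻¹} a)) D(s)`. -/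
noncomputable def liftSkewSum : θ.skewSum →ₐ[K] B :=
  AlgHom.ofLinearMap (liftFinsupp ι D ∘ₗ θ.skewSum.subtype)
    ((liftFinsupp_single ι D 1 1).trans (by rw [_root_.map_one, _root_.map_one, mul_one]))
    (fun f g => liftFinsupp_mulAux θ ι D h f.1 g.1)

variable (hle : ∀ s t a, NatLE s t → θ.unit s * a = a → ι a * D s = ι a * D t)

include hle in
theorem ideal_le_ker_liftSkewSum : θ.ideal ≤ TwoSidedIdeal.ker (liftSkewSum θ ι D h) := by
  rw [ideal, TwoSidedIdeal.span_le]
  rintro x ⟨s, t, a, hst, ha, hx⟩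
  refine (TwoSidedIdeal.mem_ker _).2 ?_
  change liftFinsupp ι D x.1 = 0
  rw [hx, _root_.map_sub, liftFinsupp_single, liftFinsupp_single, hle s t a hst ha, sub_self]

/-- The homomorphism from the crossed product given by a covariant pair `(ι, D)` compatible with
the natural partial order. -/
noncomputable def liftCrossedProduct : θ.CrossedProduct →ₐ[K] B :=
  RingCon.liftₐ θ.ideal.ringCon (liftSkewSum θ ι D h) (fun x y hxy => by
    have h_ker := ideal_le_ker_liftSkewSum θ ι D h hle ((TwoSidedIdeal.rel_iff _ _ _).1 hxy)
    rwa [TwoSidedIdeal.mem_ker, _root_.map_sub, sub_eq_zero] at h_ker)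

theorem liftCrossedProduct_incl (a : A) : liftCrossedProduct θ ι D h hle (θ.incl a) = ι a :=
  (liftFinsupp_single ι D 1 a).trans (by rw [_root_.map_one, mul_one])

theorem liftCrossedProduct_delta (s : S) :
    liftCrossedProduct θ ι D h hle (θ.delta s) = ι (θ.unit s) * D s :=
  liftFinsupp_single ι D s (θ.unit s)

end Lift

end UnitalAction

/-! ### Bimodules and their invariants -/

namespace Envelope

section Actions

variable (K : Type*) {R M : Type*} [CommRing K] [Ring R] [Algebra K R]
  [AddCommGroup M] [Module (Envelope K R) M]

/-- The left multiplication `x m` on a bimodule, encoded as a left `Rᵉ`-module. -/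
noncomputable def lact (x : R) (m : M) : M := (x ⊗ₜ[K] (1 : Rᵐᵒᵖ) : Envelope K R) • m

/-- The right multiplication `m x` on a bimodule, encoded as a left `Rᵉ`-module. -/
noncomputable def ract (m : M) (x : R) : M := ((1 : R) ⊗ₜ[K] op x : Envelope K R) • m

theorem tmul_smul (x : R) (y : Rᵐᵒᵖ) (m : M) :
    (x ⊗ₜ[K] y : Envelope K R) • m = lact K x (ract K m y.unop) := by
  rw [lact, ract, smul_smul, Algebra.TensorProduct.tmul_mul_tmul, one_mul, mul_one, op_unop]

theorem mul_lact (x y : R) (m : M) : lact K (x * y) m = lact K x (lact K y m) := by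
  rw [lact, lact, lact, smul_smul, Algebra.TensorProduct.tmul_mul_tmul, mul_one]

theorem ract_mul (x y : R) (m : M) : ract K m (x * y) = ract K (ract K m x) y := by
  rw [ract, ract, ract, smul_smul, Algebra.TensorProduct.tmul_mul_tmul, mul_one, op_mul]

theorem ract_lact (x y : R) (m : M) : ract K (lact K x m) y = lact K x (ract K m y) := by
  rw [lact, ract, lact, ract, smul_smul, smul_smul, Algebra.TensorProduct.tmul_mul_tmul,
    Algebra.TensorProduct.tmul_mul_tmul, mul_one, one_mul, mul_one, one_mul]

@[simp] theorem one_lact (m : M) : lact K (1 : R) m = m := one_smul (Envelope K R) m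

@[simp] theorem ract_one (m : M) : ract K m (1 : R) = m := one_smul (Envelope K R) m

theorem lact_add (x : R) (m n : M) : lact K x (m + n) = lact K x m + lact K x n := smul_add _ _ _

theorem add_ract (x : R) (m n : M) : ract K (m + n) x = ract K m x + ract K n x := smul_add _ _ _

@[simp] theorem lact_zero (x : R) : lact K x (0 : M) = 0 := smul_zero _

@[simp] theorem zero_ract (x : R) : ract K (0 : M) x = 0 := smul_zero _

theorem add_lact (x y : R) (m : M) : lact K (x + y) m = lact K x m + lact K y m := by
  rw [lact, add_tmul, add_smul]; rfl

theorem ract_add (x y : R) (m : M) : ract K m (x + y) = ract K m x + ract K m y := by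
  have h : ((1 : R) ⊗ₜ[K] op (x + y) : Envelope K R) = 1 ⊗ₜ[K] op x + 1 ⊗ₜ[K] op y :=
    tmul_add _ _ _
  rw [ract, h, add_smul]; rfl

@[simp] theorem zero_lact (m : M) : lact K (0 : R) m = 0 := by
  rw [lact, zero_tmul]; exact zero_smul (Envelope K R) m

@[simp] theorem ract_zero (m : M) : ract K m (0 : R) = 0 := by
  rw [ract, op_zero, tmul_zero]; exact zero_smul (Envelope K R) m

section Scalars

variable [Module K M] [IsScalarTower K (Envelope K R) M]

theorem ract_smul (r : K) (x : R) (m : M) : ract K m (r • x) = r • ract K m x := by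
  rw [ract, op_smul, TensorProduct.tmul_smul, smul_assoc]; rfl

theorem ract_algebraMap (r : K) (m : M) : ract K m (algebraMap K R r) = r • m := by
  rw [Algebra.algebraMap_eq_smul_one, ract_smul, ract_one]

theorem lact_smul (r : K) (x : R) (m : M) : lact K x (r • m) = r • lact K x m := smul_comm _ _ _

theorem smul_ract (r : K) (x : R) (m : M) : ract K (r • m) x = r • ract K m x := smul_comm _ _ _

end Scalars

variable {K} in
theorem map_smul_of_map_lact_of_map_ract {N : Type*} [AddCommGroup N] [Module (Envelope K R) N]
    (f : M →+ N) (h_lact : ∀ (x : R) (m : M), f (lact K x m) = lact K x (f m))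
    (h_ract : ∀ (x : R) (m : M), f (ract K m x) = ract K (f m) x)
    (z : Envelope K R) (m : M) : f (z • m) = z • f m := by
  induction z using TensorProduct.induction_on with
  | zero =>
    exact (congrArg f (zero_smul (Envelope K R) m)).trans
      (f.map_zero.trans (zero_smul (Envelope K R) (f m)).symm)
  | add z z' hz hz' => rw [add_smul, add_smul, f.map_add, hz, hz']
  | tmul x y => rw [tmul_smul, tmul_smul, h_lact, h_ract]

end Actions

section Regular

variable {K R : Type u} [CommRing K] [Ring R] [Algebra K R]

theorem hom_lact {M N : ModuleCat.{u} (Envelope K R)} (g : M ⟶ N) (x : R) (m : M) :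
    g.hom (lact K x m) = lact K x (g.hom m) := g.hom.map_smul _ _

theorem hom_ract {M N : ModuleCat.{u} (Envelope K R)} (g : M ⟶ N) (x : R) (m : M) :
    g.hom (ract K m x) = ract K (g.hom m) x := g.hom.map_smul _ _

variable (K) in
/-- An element of `R` as an element of the regular bimodule. -/
noncomputable def toRegularBimodule : R →+ regularBimodule K R where
  toFun y := y
  map_zero' := rfl
  map_add' _ _ := rfl

theorem lact_toRegularBimodule (x y : R) :
    lact K x (toRegularBimodule K y) = toRegularBimodule K (x * y) :=
  congrArg (x * ·) (mul_one y)

theorem ract_toRegularBimodule (x y : R) :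
    ract K (toRegularBimodule K y) x = toRegularBimodule K (y * x) :=
  one_mul (y * x)

theorem regularBimodule_hom_ext {M : ModuleCat.{u} (Envelope K R)} {g g' : regularBimodule K R ⟶ M}
    (h : g.hom (toRegularBimodule K 1) = g'.hom (toRegularBimodule K 1)) : g = g' := by
  ext (y : R)
  change g.hom (toRegularBimodule K y) = g'.hom (toRegularBimodule K y)
  rw [← mul_one y, ← lact_toRegularBimodule, hom_lact, hom_lact, h]

end Regular

section Invariants

variable {K R : Type u} [Field K] [Ring R] [Algebra K R] (M : ModuleCat.{u} (Envelope K R))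

/-- The `K`-module of invariants of a bimodule: the `m` with `x m = m x` for all `x`. -/
noncomputable def invariants : Submodule K M where
  carrier := {m | ∀ x : R, lact K x m = ract K m x}
  add_mem' hm hn x := by rw [lact_add, add_ract, hm, hn]
  zero_mem' x := by rw [lact_zero, zero_ract]
  smul_mem' r m hm x := by rw [lact_smul, smul_ract, hm]

/-- The bimodule homomorphism `R ⟶ M`, `y ↦ y m`, given by an invariant `m`. -/
noncomputable def regularBimoduleHomMk (m : invariants M) : regularBimodule K R ⟶ M :=
  ModuleCat.ofHom (X := regularBimodule K R) (Y := M)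
    { toFun (y : regularBimodule K R) := lact K (show R from y) m.1
      map_add' x y := add_lact K _ _ m.1
      map_smul' := map_smul_of_map_lact_of_map_ract (M := regularBimodule K R)
        (AddMonoidHom.mk' (fun y => lact K (show R from y) m.1) fun x y => add_lact K _ _ m.1)
        (fun x (y : R) => (congrArg (lact (R := R) K · m.1) (lact_toRegularBimodule x y)).trans
          (mul_lact K x y m.1))
        (fun x (y : R) => (congrArg (lact (R := R) K · m.1) (ract_toRegularBimodule x y)).trans (by
          change lact K (y * x) m.1 = ract K (lact K y m.1) x
          rw [mul_lact, m.2, ract_lact])) }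

variable {M}

theorem hom_toRegularBimodule_one_mem (g : regularBimodule K R ⟶ M) :
    g.hom (toRegularBimodule K 1) ∈ invariants M := fun x => by
  rw [← hom_lact, ← hom_ract, lact_toRegularBimodule, ract_toRegularBimodule, mul_one, one_mul]

variable (M) in
/-- `Hom_{Rᵉ}(R, M)` is the module of invariants of `M`, through evaluation at `1`. -/
noncomputable def regularBimoduleHomEquiv :
    (regularBimodule K R ⟶ M) ≃ₗ[K] invariants M where
  toFun g := ⟨_, hom_toRegularBimodule_one_mem g⟩
  map_add' _ _ := rfl
  map_smul' _ _ := rfl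
  invFun := regularBimoduleHomMk M
  left_inv _ := regularBimodule_hom_ext (one_lact K _)
  right_inv m := Subtype.ext (one_lact K m.1)

end Invariants

end Envelope

/-! ### The functor `T₁` through evaluation at `1` -/

namespace UnitalAction

open InverseMonoid Envelope

section HomAe

attribute [local instance] instModuleTensorProductMop

variable {K S A : Type*} [Field K] [InverseMonoid S] [Ring A] [Algebra K A]
variable (θ : UnitalAction K S A)
variable {M : Type*} [AddCommGroup M] [Module (Envelope K θ.CrossedProduct) M]

theorem homAe_apply_eq_lact (f : θ.HomAe M) (a : A) : f a = lact K (θ.incl a) (f 1) := by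
  have h : (a ⊗ₜ[K] (1 : Aᵐᵒᵖ) : Envelope K A) • (1 : A) = a :=
    (congrArg (a * ·) (mul_one 1)).trans (mul_one a)
  conv_lhs => rw [← h, LinearMap.map_smulₛₗ]
  change (θ.incl a ⊗ₜ[K] op (θ.incl 1) : Envelope K θ.CrossedProduct) • _ = _
  rw [_root_.map_one]
  rfl

theorem homAe_apply_eq_ract (f : θ.HomAe M) (a : A) : f a = ract K (f 1) (θ.incl a) := by
  have h : ((1 : A) ⊗ₜ[K] op a : Envelope K A) • (1 : A) = a :=
    (one_mul (1 * a)).trans (one_mul a)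
  conv_lhs => rw [← h, LinearMap.map_smulₛₗ]
  change (θ.incl 1 ⊗ₜ[K] op (θ.incl a) : Envelope K θ.CrossedProduct) • _ = _
  rw [_root_.map_one]
  rfl

theorem homAe_ext {f g : θ.HomAe M} (h : f 1 = g 1) : f = g :=
  LinearMap.ext fun a => by rw [homAe_apply_eq_lact, h, ← homAe_apply_eq_lact]

/-- The element `a ↦ a m` of `Hom_{Aᵉ}(A, M)` given by an `m` commuting with `A`. -/
noncomputable def homAeMk (m : M)
    (hm : ∀ a, lact K (θ.incl a) m = ract K m (θ.incl a)) : θ.HomAe M where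
  toFun a := lact K (θ.incl a) m
  map_add' a b := by rw [_root_.map_add, add_lact]
  map_smul' z a := by
    induction z using TensorProduct.induction_on with
    | zero =>
      refine (congrArg (fun w : A => lact K (θ.incl w) m) (zero_smul (Envelope K A) a)).trans ?_
      rw [_root_.map_zero, zero_lact, _root_.map_zero]
      exact (zero_smul (Envelope K θ.CrossedProduct) (lact K (θ.incl a) m)).symm
    | add z z' hz hz' =>
      rw [add_smul, _root_.map_add, add_lact, hz, hz', _root_.map_add, add_smul]
    | tmul b c =>
      change lact K (θ.incl (b * (a * c.unop))) m =
        (θ.incl b ⊗ₜ[K] op (θ.incl c.unop) : Envelope K θ.CrossedProduct) • lact K (θ.incl a) m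
      rw [_root_.map_mul, _root_.map_mul, mul_lact, mul_lact, hm, Envelope.tmul_smul, ract_lact,
        unop_op]

theorem homAeMk_apply_one (m : M) (hm : ∀ a, lact K (θ.incl a) m = ract K m (θ.incl a)) :
    θ.homAeMk m hm 1 = m := by
  change lact K (θ.incl 1) m = m
  rw [_root_.map_one, one_lact]

theorem homRep_apply_one [Module K M] [IsScalarTower K (Envelope K θ.CrossedProduct) M] (s : S)
    (f : θ.HomAe M) :
    θ.homRep M s f 1 = lact K (θ.delta s) (ract K (f 1) (θ.delta s⁻¹)) := by
  change θ.conj s • f (θ.act s⁻¹ 1) = _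
  rw [homAe_apply_eq_lact, act_unit]
  change (θ.delta s ⊗ₜ[K] op (θ.delta s⁻¹) : Envelope K θ.CrossedProduct) • _ = _
  rw [Envelope.tmul_smul, ract_lact, ← mul_lact, delta_mul_incl_unit_inv, unop_op]

end HomAe

section EvalOne

variable {K S A : Type u} [Field K] [InverseMonoid S] [Ring A] [Algebra K A]
variable (θ : UnitalAction K S A) (M : ModuleCat.{u} (Envelope K θ.CrossedProduct))

attribute [local instance] instModuleTensorProductMop

/-- The evaluation `f ↦ f 1` on `T₁ M = Hom_{Aᵉ}(A, M)`, which identifies `T₁ M` with the elements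
of `M` commuting with `A`. -/
noncomputable def evalOne : θ.T1.obj M →+ M where
  toFun f := (θ.homRep M).asModuleEquiv f 1
  map_zero' := rfl
  map_add' _ _ := rfl

variable {M}

theorem evalOne_injective : Function.Injective (θ.evalOne M) := fun _ _ h =>
  (θ.homRep M).asModuleEquiv.injective (θ.homAe_ext h)

theorem evalOne_algebraMap_smul (r : K) (f : θ.T1.obj M) :
    θ.evalOne M (algebraMap K (MonoidAlgebra K S) r • f) = r • θ.evalOne M f := by
  have h : r • (θ.homRep M).asModuleEquiv f = algebraMap K (MonoidAlgebra K S) r • f :=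
    (θ.homRep M).asModuleEquiv_symm_map_smul r ((θ.homRep M).asModuleEquiv f)
  exact (congrArg (θ.evalOne M) h).symm

theorem evalOne_of_smul (s : S) (f : θ.T1.obj M) :
    θ.evalOne M (MonoidAlgebra.of K S s • f) =
      lact K (θ.delta s) (ract K (θ.evalOne M f) (θ.delta s⁻¹)) := by
  have h : θ.homRep M s ((θ.homRep M).asModuleEquiv f) = MonoidAlgebra.of K S s • f :=
    (θ.homRep M).asModuleEquiv_symm_map_rho s ((θ.homRep M).asModuleEquiv f)
  exact (congrArg (θ.evalOne M) h).symm.trans (θ.homRep_apply_one s _)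

theorem lact_incl_evalOne (a : A) (f : θ.T1.obj M) :
    lact K (θ.incl a) (θ.evalOne M f) = ract K (θ.evalOne M f) (θ.incl a) :=
  (θ.homAe_apply_eq_lact ((θ.homRep M).asModuleEquiv f) a).symm.trans
    (θ.homAe_apply_eq_ract _ a)

/-- The element of `T₁ M` with value `m` at `1`. -/
noncomputable def t1Mk (m : M) (hm : ∀ a, lact K (θ.incl a) m = ract K m (θ.incl a)) :
    θ.T1.obj M := (θ.homRep M).asModuleEquiv.symm (θ.homAeMk m hm)

theorem evalOne_t1Mk (m : M) (hm : ∀ a, lact K (θ.incl a) m = ract K m (θ.incl a)) :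
    θ.evalOne M (θ.t1Mk m hm) = m := θ.homAeMk_apply_one m hm

section HomMk

variable {V : ModuleCat.{u} (MonoidAlgebra K S)} (φ : V →+ M)
  (hA : ∀ a v, lact K (θ.incl a) (φ v) = ract K (φ v) (θ.incl a))
  (hK : ∀ (r : K) v, φ (algebraMap K (MonoidAlgebra K S) r • v) = r • φ v)
  (hS : ∀ s v, φ (MonoidAlgebra.of K S s • v) =
    lact K (θ.delta s) (ract K (φ v) (θ.delta s⁻¹)))

/-- The homomorphism `V ⟶ T₁ M` whose composition with the evaluation at `1` is a given equivariant
map from `V` to the elements of `M` commuting with `A`. -/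
noncomputable def t1HomMk : V ⟶ θ.T1.obj M :=
  ModuleCat.ofHom (Y := θ.T1.obj M)
    { toFun v := θ.t1Mk (φ v) (fun a => hA a v)
      map_add' v w := θ.evalOne_injective (by
        rw [(θ.evalOne M).map_add, evalOne_t1Mk, evalOne_t1Mk, evalOne_t1Mk, φ.map_add])
      map_smul' x v := θ.evalOne_injective (by
        refine (θ.evalOne_t1Mk _ _).trans ?_
        change _ = θ.evalOne M (x • θ.t1Mk (φ v) (fun a => hA a v))
        induction x using MonoidAlgebra.induction_on with
        | of s => rw [hS, evalOne_of_smul, evalOne_t1Mk]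
        | add x y hx hy => rw [add_smul, φ.map_add, hx, hy, add_smul, (θ.evalOne M).map_add]
        | smul r x hx =>
          rw [Algebra.smul_def, mul_smul, mul_smul, hK, hx, evalOne_algebraMap_smul]) }

theorem evalOne_t1HomMk (v : V) : θ.evalOne M ((θ.t1HomMk φ hA hK hS).hom v) = φ v :=
  θ.evalOne_t1Mk (φ v) _

end HomMk

theorem evalOne_t1_map {N : ModuleCat.{u} (Envelope K θ.CrossedProduct)} (g : M ⟶ N)
    (f : θ.T1.obj M) : θ.evalOne N ((θ.T1.map g).hom f) = g.hom (θ.evalOne M f) := rfl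

end EvalOne

end UnitalAction

/-! ### Invariants as homomorphisms from the trivial module -/

namespace InverseMonoid

variable (K : Type u) {S : Type u} [Field K] [InverseMonoid S]

/-- The basis element of `KE(S)` attached to an idempotent. -/
noncomputable def trivialModuleSingle (e : Idem S) : trivialModule K S :=
  (Representation.ofMulAction K S (Idem S)).asModuleEquiv.symm (MonoidAlgebra.single e 1)

theorem of_smul_trivialModuleSingle (s : S) (e : Idem S) :
    MonoidAlgebra.of K S s • trivialModuleSingle K e = trivialModuleSingle K (s • e) := by
  refine ((Representation.ofMulAction K S (Idem S)).asModuleEquiv_symm_map_rho s _).symm.trans ?_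
  rw [Representation.ofMulAction_single]
  rfl

variable {K}

theorem trivialModule_hom_ext {V : ModuleCat.{u} (MonoidAlgebra K S)} {f g : trivialModule K S ⟶ V}
    (h : f.hom (trivialModuleSingle K (idemOne S)) = g.hom (trivialModuleSingle K (idemOne S))) :
    f = g := by
  ext (x : MonoidAlgebra K (Idem S))
  induction x using MonoidAlgebra.induction_linear with
  | zero => exact f.hom.map_zero.trans g.hom.map_zero.symm
  | add x y hx hy =>
    exact (f.hom.map_add _ _).trans ((congrArg₂ _ hx hy).trans (g.hom.map_add _ _).symm)
  | single e r =>
    have h_single : (show trivialModule K S from MonoidAlgebra.single e r) =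
        (algebraMap K (MonoidAlgebra K S) r * MonoidAlgebra.of K S e.1) •
          trivialModuleSingle K (idemOne S) := by
      rw [mul_smul, of_smul_trivialModuleSingle, coe_smul_idemOne_self]
      refine Eq.trans ?_
        ((Representation.ofMulAction K S (Idem S)).asModuleEquiv_symm_map_smul r _)
      rw [MonoidAlgebra.smul_single, smul_eq_mul, mul_one]
      rfl
    refine (congrArg f.hom h_single).trans (Eq.trans ?_ (congrArg g.hom h_single).symm)
    rw [map_smul, map_smul, h]

variable {V : ModuleCat.{u} (MonoidAlgebra K S)}

theorem of_smul_hom_trivialModuleSingle_one (f : trivialModule K S ⟶ V) (s : S) :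
    MonoidAlgebra.of K S s • f.hom (trivialModuleSingle K (idemOne S)) =
      MonoidAlgebra.of K S (s * s⁻¹) • f.hom (trivialModuleSingle K (idemOne S)) := by
  have h : s • idemOne S = (s * s⁻¹) • idemOne S := Subtype.ext (by
    rw [coe_smul_idemOne, coe_smul_idemOne, inv_of_idem (mul_inv_idem s), mul_inv_idem])
  rw [← map_smul, ← map_smul, of_smul_trivialModuleSingle, of_smul_trivialModuleSingle, h]

section HomMk

variable (v : V)

/-- The `K`-linear map `KE(S) → V`, `e ↦ e v`. -/
noncomputable def idemLinearMap : MonoidAlgebra K (Idem S) →ₗ[K] V :=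
  Finsupp.linearCombination K (fun e : Idem S => MonoidAlgebra.of K S e.1 • v) ∘ₗ
    (MonoidAlgebra.coeffLinearEquiv K).toLinearMap

theorem idemLinearMap_single (e : Idem S) (r : K) :
    idemLinearMap v (MonoidAlgebra.single e r) = r • MonoidAlgebra.of K S e.1 • v :=
  Finsupp.linearCombination_single K r e

variable (hv : ∀ s : S, MonoidAlgebra.of K S s • v = MonoidAlgebra.of K S (s * s⁻¹) • v)

include hv in
theorem idemLinearMap_ofMulAction (s : S) (x : MonoidAlgebra K (Idem S)) :
    idemLinearMap v (Representation.ofMulAction K S (Idem S) s x) =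
      MonoidAlgebra.of K S s • idemLinearMap v x := by
  induction x using MonoidAlgebra.induction_linear with
  | zero => rw [map_zero, map_zero, smul_zero]
  | add x y hx hy => rw [map_add, map_add, map_add, hx, hy, smul_add]
  | single e r =>
    have h_conj : (s * e.1) * (s * e.1)⁻¹ = (s • e).1 := by
      rw [mul_inv_rev', inv_of_idem e.2, ← mul_assoc, mul_assoc s, e.2]
      rfl
    rw [Representation.ofMulAction_single, idemLinearMap_single, idemLinearMap_single,
      smul_comm (MonoidAlgebra.of K S s) r, smul_smul (MonoidAlgebra.of K S s), ← map_mul,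
      hv (s * e.1), h_conj]

/-- The homomorphism `KE(S) ⟶ V`, `e ↦ e v`, given by a `v` with `s v = (s s⁻¹) v` for all `s`. -/
noncomputable def trivialModuleHomMk : trivialModule K S ⟶ V :=
  ModuleCat.ofHom (MonoidAlgebra.equivariantOfLinearOfComm
    (idemLinearMap v ∘ₗ (Representation.ofMulAction K S (Idem S)).asModuleEquiv.toLinearMap)
    (fun s x => by
      rw [Representation.single_smul, one_smul]
      exact idemLinearMap_ofMulAction v hv s _))

theorem trivialModuleHomMk_single_one :
    (trivialModuleHomMk v hv).hom (trivialModuleSingle K (idemOne S)) = v := by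
  refine (idemLinearMap_single v (idemOne S) 1).trans ?_
  rw [one_smul]
  exact (congrArg (· • v) (map_one (MonoidAlgebra.of K S))).trans (one_smul _ v)

end HomMk

end InverseMonoid

namespace UnitalAction

open InverseMonoid Envelope

section Invariants

variable {K S A : Type*} [CommRing K] [InverseMonoid S] [Ring A] [Algebra K A]
variable (θ : UnitalAction K S A)
variable {M : Type*} [AddCommGroup M] [Module (Envelope K θ.CrossedProduct) M]

theorem lact_eq_ract_of_generators {m : M} (hA : ∀ a, lact K (θ.incl a) m = ract K m (θ.incl a))
    (hS : ∀ s, lact K (θ.delta s) m = ract K m (θ.delta s)) (x : θ.CrossedProduct) :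
    lact K x m = ract K m x := by
  induction x using θ.crossedProduct_induction with
  | zero => rw [zero_lact, ract_zero]
  | add x y hx hy => rw [add_lact, ract_add, hx, hy]
  | incl_mul_delta a s => rw [mul_lact, ract_mul, hS, ← ract_lact, hA]

theorem lact_delta_eq_ract_delta_iff {m : M}
    (hA : ∀ a, lact K (θ.incl a) m = ract K m (θ.incl a)) (s : S) :
    lact K (θ.delta s) m = ract K m (θ.delta s) ↔
      lact K (θ.delta s) (ract K m (θ.delta s⁻¹)) =
        lact K (θ.delta (s * s⁻¹)) (ract K m (θ.delta (s * s⁻¹)⁻¹)) := by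
  have h_idem {e : S} (he : e * e = e) : lact K (θ.delta e) m = ract K m (θ.delta e) := by
    rw [delta_of_idem θ he, hA]
  have h_range : lact K (θ.delta (s * s⁻¹)) (ract K m (θ.delta (s * s⁻¹)⁻¹)) =
      ract K m (θ.delta (s * s⁻¹)) := by
    rw [inv_of_idem (mul_inv_idem s), ← ract_lact, h_idem (mul_inv_idem s), ← ract_mul,
      ← _root_.map_mul, mul_inv_idem]
  rw [h_range]
  constructor
  · intro h
    rw [← ract_lact, h, ← ract_mul, ← _root_.map_mul]
  · intro h
    calc lact K (θ.delta s) m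
        = lact K (θ.delta s) (ract K m (θ.delta (s⁻¹ * s))) := by
          rw [← h_idem (inv_mul_idem s), ← mul_lact, ← _root_.map_mul, ← mul_assoc, mul_inv_mul]
      _ = ract K (lact K (θ.delta s) (ract K m (θ.delta s⁻¹))) (θ.delta s) := by
          rw [ract_lact, ← ract_mul, ← _root_.map_mul]
      _ = ract K m (θ.delta s) := by
          rw [h, ← ract_mul, ← _root_.map_mul, mul_inv_mul]

end Invariants

variable {K S A : Type u} [Field K] [InverseMonoid S] [Ring A] [Algebra K A]
variable (θ : UnitalAction K S A) {M : ModuleCat.{u} (Envelope K θ.CrossedProduct)}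

theorem evalOne_mem_invariants_iff (f : θ.T1.obj M) : θ.evalOne M f ∈ invariants M ↔
    ∀ s, MonoidAlgebra.of K S s • f = MonoidAlgebra.of K S (s * s⁻¹) • f := by
  have h_iff (s : S) := θ.lact_delta_eq_ract_delta_iff (θ.lact_incl_evalOne · f) s
  simp only [← evalOne_of_smul, θ.evalOne_injective.eq_iff] at h_iff
  exact ⟨fun h s => (h_iff s).1 (h _),
    fun h => θ.lact_eq_ract_of_generators (θ.lact_incl_evalOne · f) fun s => (h_iff s).2 (h s)⟩

theorem of_smul_t1Mk_of_mem_invariants {m : M} (hm : m ∈ invariants M) (s : S) :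
    MonoidAlgebra.of K S s • θ.t1Mk m (fun _ => hm _) =
      MonoidAlgebra.of K S (s * s⁻¹) • θ.t1Mk m (fun _ => hm _) :=
  (θ.evalOne_mem_invariants_iff _).1 (by rwa [evalOne_t1Mk]) s

/-- `Hom_{KS}(KE(S), T₁ M)` is the module of invariants of the bimodule `M`. -/
noncomputable def trivialModuleHomEquivInvariants :
    (trivialModule K S ⟶ θ.T1.obj M) ≃ₗ[K] invariants M where
  toFun f := ⟨θ.evalOne M (f.hom (trivialModuleSingle K (idemOne S))),
    (θ.evalOne_mem_invariants_iff _).2 (of_smul_hom_trivialModuleSingle_one f)⟩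
  map_add' _ _ := rfl
  map_smul' r _ := Subtype.ext (θ.evalOne_algebraMap_smul r _)
  invFun m := trivialModuleHomMk _ (θ.of_smul_t1Mk_of_mem_invariants m.2)
  left_inv _ := trivialModule_hom_ext ((trivialModuleHomMk_single_one _ _).trans
    (θ.evalOne_injective (θ.evalOne_t1Mk _ _)))
  right_inv m := Subtype.ext ((congrArg (θ.evalOne M) (trivialModuleHomMk_single_one _ _)).trans
    (θ.evalOne_t1Mk m.1 _))

variable (M) in
/-- `Hom_{KS}(KE(S), T₁ M) ≅ Hom_{Λᵉ}(Λ, M)` for the crossed product `Λ`. -/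
noncomputable def trivialModuleHomEquivRegular :
    (trivialModule K S ⟶ θ.T1.obj M) ≃ₗ[K] (regularBimodule K θ.CrossedProduct ⟶ M) :=
  θ.trivialModuleHomEquivInvariants ≪≫ₗ (regularBimoduleHomEquiv M).symm

theorem trivialModuleHomEquivRegular_comp {N : ModuleCat.{u} (Envelope K θ.CrossedProduct)}
    (g : M ⟶ N) (f : trivialModule K S ⟶ θ.T1.obj M) :
    θ.trivialModuleHomEquivRegular N (f ≫ θ.T1.map g) =
      θ.trivialModuleHomEquivRegular M f ≫ g := by
  have h_one {M : ModuleCat.{u} (Envelope K θ.CrossedProduct)}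
      (f : trivialModule K S ⟶ θ.T1.obj M) :
      (θ.trivialModuleHomEquivRegular M f).hom (toRegularBimodule K 1) =
        θ.evalOne M (f.hom (trivialModuleSingle K (idemOne S))) :=
    congrArg Subtype.val ((regularBimoduleHomEquiv M).apply_symm_apply
      (θ.trivialModuleHomEquivInvariants f))
  exact regularBimodule_hom_ext ((h_one _).trans (congrArg g.hom (h_one f).symm))

end UnitalAction

/-! ### The induced bimodules -/

namespace UnitalAction

open InverseMonoid Envelope

variable {K S A : Type u} [Field K] [InverseMonoid S] [Ring A] [Algebra K A]
variable (θ : UnitalAction K S A)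

section Ind

variable (K S) in
/-- The algebra `KE` of the submonoid of idempotents of `S`, mapped to the monoid algebra `KS`. -/
noncomputable def idemAlgHom : MonoidAlgebra K (idemSubmonoid S) →ₐ[K] MonoidAlgebra K S :=
  MonoidAlgebra.lift K _ _ ((MonoidAlgebra.of K S).comp (idemSubmonoid S).subtype)

/-- The algebra `KE` of the submonoid of idempotents of `S`, mapped to the crossed product by
`e ↦ 1_e δ_e`. -/
noncomputable def idemCrossedProduct : MonoidAlgebra K (idemSubmonoid S) →ₐ[K] θ.CrossedProduct :=
  MonoidAlgebra.lift K _ _ (θ.delta.comp (idemSubmonoid S).subtype)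

/-- The crossed product as a `KE`-module, by left multiplication. -/
@[reducible]
noncomputable def moduleIdemCrossedProduct :
    Module (MonoidAlgebra K (idemSubmonoid S)) θ.CrossedProduct :=
  Module.compHom _ θ.idemCrossedProduct.toRingHom

/-- A `KS`-module as a `KE`-module. -/
@[reducible]
noncomputable def moduleIdem (V : ModuleCat.{u} (MonoidAlgebra K S)) :
    Module (MonoidAlgebra K (idemSubmonoid S)) V :=
  Module.compHom _ (idemAlgHom K S).toRingHom

attribute [local instance] moduleIdemCrossedProduct moduleIdem

variable (V : ModuleCat.{u} (MonoidAlgebra K S))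

/-- The bimodule over the crossed product `Λ` induced by a `KS`-module `V`. It is `Λ ⊗ V` over the
algebra `KE` of the idempotents of `S`, where `KE` acts on `Λ` from the left, with
`a δ_s (x ⊗ v) y = a δ_s x y ⊗ s v`. -/
def Ind : Type u := θ.CrossedProduct ⊗[MonoidAlgebra K (idemSubmonoid S)] V

noncomputable instance : AddCommGroup (θ.Ind V) :=
  inferInstanceAs (AddCommGroup (θ.CrossedProduct ⊗[MonoidAlgebra K (idemSubmonoid S)] V))

noncomputable instance : Module (MonoidAlgebra K (idemSubmonoid S)) (θ.Ind V) :=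
  inferInstanceAs (Module (MonoidAlgebra K (idemSubmonoid S))
    (θ.CrossedProduct ⊗[MonoidAlgebra K (idemSubmonoid S)] V))

noncomputable instance : Module K (θ.Ind V) :=
  Module.compHom _ (algebraMap K (MonoidAlgebra K (idemSubmonoid S)))

theorem algebraMap_smul_crossedProduct (r : K) (x : θ.CrossedProduct) :
    algebraMap K (MonoidAlgebra K (idemSubmonoid S)) r • x = r • x := by
  change θ.idemCrossedProduct (algebraMap K _ r) * x = _
  rw [AlgHom.commutes, Algebra.smul_def]

variable {V} in
theorem algebraMap_smul_module (r : K) (v : V) :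
    algebraMap K (MonoidAlgebra K (idemSubmonoid S)) r • v = r • v := by
  change idemAlgHom K S (algebraMap K _ r) • v = algebraMap K (MonoidAlgebra K S) r • v
  rw [AlgHom.commutes]

/-- The element `x ⊗ v` of the induced bimodule. -/
noncomputable def indMk : θ.CrossedProduct →ₗ[K] V →ₗ[K] θ.Ind V :=
  LinearMap.mk₂ K (fun x v => (x ⊗ₜ[MonoidAlgebra K (idemSubmonoid S)] v :
      θ.CrossedProduct ⊗[MonoidAlgebra K (idemSubmonoid S)] V))
    (fun _ _ _ => add_tmul _ _ _)
    (fun r x v => by rw [← algebraMap_smul_crossedProduct, ← smul_tmul']; rfl)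
    (fun _ _ _ => tmul_add _ _ _)
    (fun r x v => by rw [← algebraMap_smul_module, TensorProduct.tmul_smul]; rfl)

variable {V}

theorem indMk_delta_mul {e : S} (he : e * e = e) (x : θ.CrossedProduct) (v : V) :
    θ.indMk V (θ.delta e * x) v = θ.indMk V x (MonoidAlgebra.of K S e • v) := by
  let r : MonoidAlgebra K (idemSubmonoid S) := MonoidAlgebra.of K _ ⟨e, he⟩
  have h_crossed : r • x = θ.delta e * x := congrArg (· * x) (MonoidAlgebra.lift_of _ _)
  have h_module : r • v = MonoidAlgebra.of K S e • v :=
    congrArg (· • v) (MonoidAlgebra.lift_of ((MonoidAlgebra.of K S).comp _) _)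
  rw [← h_crossed, ← h_module]
  exact smul_tmul r x v

theorem ind_induction {P : θ.Ind V → Prop} (m : θ.Ind V) (mk : ∀ x v, P (θ.indMk V x v))
    (add : ∀ m n, P m → P n → P (m + n)) : P m := by
  induction m using TensorProduct.induction_on with
  | zero => exact ((θ.indMk V 0).map_zero : _) ▸ mk 0 0
  | add m n hm hn => exact add m n hm hn
  | tmul x v => exact mk x v

theorem ind_hom_ext {P : Type*} [AddCommGroup P] [Module K P] {f g : θ.Ind V →ₗ[K] P}
    (h : ∀ x v, f (θ.indMk V x v) = g (θ.indMk V x v)) : f = g :=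
  LinearMap.ext fun m => θ.ind_induction (P := fun m => f m = g m) m h fun m n hm hn => by
    rw [_root_.map_add, _root_.map_add, hm, hn]

section Lift

variable {P : Type*} [AddCommGroup P] [Module K P] (b : θ.CrossedProduct →ₗ[K] V →ₗ[K] P)
  (hb : ∀ e : S, e * e = e → ∀ x v, b (θ.delta e * x) v = b x (MonoidAlgebra.of K S e • v))

include hb in
theorem balanced_of_idem (r : MonoidAlgebra K (idemSubmonoid S)) (x : θ.CrossedProduct) (v : V) :
    b (r • x) v = b x (r • v) := by
  induction r using MonoidAlgebra.induction_on with
  | of e =>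
    change b (θ.idemCrossedProduct _ * x) v = b x (idemAlgHom K S _ • v)
    rw [idemCrossedProduct, idemAlgHom, MonoidAlgebra.lift_of, MonoidAlgebra.lift_of]
    exact hb e.1 e.2 x v
  | add r r' hr hr' =>
    rw [add_smul, add_smul, _root_.map_add, _root_.map_add, LinearMap.add_apply, hr, hr']
  | smul k r hr =>
    rw [Algebra.smul_def, mul_smul, mul_smul, algebraMap_smul_crossedProduct,
      algebraMap_smul_module, b.map_smul, (b x).map_smul, LinearMap.smul_apply, hr]

/-- The additive map underlying `indLift`. -/
noncomputable def indLiftAddHom : θ.Ind V →+ P :=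
  TensorProduct.liftAddHom (LinearMap.toAddMonoidHom'.comp b.toAddMonoidHom)
    (θ.balanced_of_idem b hb)

theorem indLiftAddHom_indMk (x : θ.CrossedProduct) (v : V) :
    θ.indLiftAddHom b hb (θ.indMk V x v) = b x v := rfl

/-- The linear map `x ⊗ v ↦ b(x, v)` on the induced bimodule given by a bilinear map `b` which is
balanced over the idempotents of `S`. -/
noncomputable def indLift : θ.Ind V →ₗ[K] P where
  __ := θ.indLiftAddHom b hb
  map_smul' r m := by
    change θ.indLiftAddHom b hb (r • m) = r • θ.indLiftAddHom b hb m
    induction m using θ.ind_induction with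
    | mk x v =>
      rw [← LinearMap.smul_apply, ← LinearMap.map_smul, indLiftAddHom_indMk, indLiftAddHom_indMk,
        LinearMap.map_smul, LinearMap.smul_apply]
    | add m n hm hn => rw [smul_add, _root_.map_add, hm, hn, _root_.map_add, smul_add]

end Lift

end Ind

section IndModule

section End

variable {V : ModuleCat.{u} (MonoidAlgebra K S)}
  (α : θ.CrossedProduct →ₗ[K] θ.CrossedProduct) (β : V →ₗ[K] V)
  (h : ∀ e : S, e * e = e → ∀ x v, θ.indMk V (α (θ.delta e * x)) (β v) =
    θ.indMk V (α x) (β (MonoidAlgebra.of K S e • v)))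

/-- The endomorphism `x ⊗ v ↦ α x ⊗ β v` of the induced bimodule. -/
noncomputable def indEnd : Module.End K (θ.Ind V) := θ.indLift ((θ.indMk V).compl₁₂ α β) h

theorem indEnd_indMk (x : θ.CrossedProduct) (v : V) :
    θ.indEnd α β h (θ.indMk V x v) = θ.indMk V (α x) (β v) := rfl

end End

variable (V : ModuleCat.{u} (MonoidAlgebra K S))

/-- The left action of `A` on the induced bimodule, `a (x ⊗ v) = a x ⊗ v`. -/
noncomputable def indIncl : A →ₐ[K] Module.End K (θ.Ind V) :=
  AlgHom.ofLinearMap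
    { toFun a := θ.indEnd (LinearMap.mulLeft K (θ.incl a)) LinearMap.id (fun e he x v => by
        rw [LinearMap.mulLeft_apply, LinearMap.mulLeft_apply, ← mul_assoc,
          incl_mul_delta_of_idem θ he, mul_assoc, indMk_delta_mul θ he, LinearMap.id_apply,
          LinearMap.id_apply])
      map_add' a b := θ.ind_hom_ext fun x v => by
        simp only [LinearMap.add_apply, indEnd_indMk, LinearMap.mulLeft_apply, _root_.map_add,
          add_mul]
      map_smul' r a := θ.ind_hom_ext fun x v => by
        simp only [LinearMap.smul_apply, indEnd_indMk, LinearMap.mulLeft_apply, _root_.map_smul,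
          smul_mul_assoc, RingHom.id_apply] }
    (θ.ind_hom_ext fun x v => by
      change θ.indMk V (θ.incl 1 * x) v = θ.indMk V x v
      rw [_root_.map_one, one_mul])
    (fun a b => θ.ind_hom_ext fun x v => by
      change θ.indMk V (θ.incl (a * b) * x) v = θ.indMk V (θ.incl a * (θ.incl b * x)) v
      rw [_root_.map_mul θ.incl, mul_assoc])

variable {V} in
theorem indIncl_indMk (a : A) (x : θ.CrossedProduct) (v : V) :
    θ.indIncl V a (θ.indMk V x v) = θ.indMk V (θ.incl a * x) v := rfl

variable {V} in
theorem indMk_delta_mul_delta_mul {e : S} (he : e * e = e) (s : S) (x : θ.CrossedProduct) (v : V) :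
    θ.indMk V (θ.delta s * (θ.delta e * x)) (MonoidAlgebra.of K S s • v) =
      θ.indMk V (θ.delta s * x) (MonoidAlgebra.of K S s • MonoidAlgebra.of K S e • v) := by
  rw [← mul_assoc, ← _root_.map_mul θ.delta, ← conj_mul_of_idem he s, _root_.map_mul θ.delta,
    mul_assoc, indMk_delta_mul θ (conj_idem he s), ← mul_smul, ← mul_smul,
    ← _root_.map_mul (MonoidAlgebra.of K S), ← _root_.map_mul (MonoidAlgebra.of K S),
    conj_mul_of_idem he]

/-- The diagonal action of `S` on the induced bimodule, `s (x ⊗ v) = δ_s x ⊗ s v`. -/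
noncomputable def indDelta : S →* Module.End K (θ.Ind V) where
  toFun s := θ.indEnd (LinearMap.mulLeft K (θ.delta s))
    (Algebra.lsmul K K V (MonoidAlgebra.of K S s)) (fun _ he => θ.indMk_delta_mul_delta_mul he s)
  map_one' := θ.ind_hom_ext fun x v => by
    change θ.indMk V (θ.delta 1 * x) (MonoidAlgebra.of K S 1 • v) = θ.indMk V x v
    rw [_root_.map_one θ.delta, _root_.map_one (MonoidAlgebra.of K S), one_mul, one_smul]
  map_mul' s t := θ.ind_hom_ext fun x v => by
    change θ.indMk V (θ.delta (s * t) * x) (MonoidAlgebra.of K S (s * t) • v) =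
      θ.indMk V (θ.delta s * (θ.delta t * x))
        (MonoidAlgebra.of K S s • MonoidAlgebra.of K S t • v)
    rw [_root_.map_mul θ.delta, _root_.map_mul (MonoidAlgebra.of K S), mul_assoc, mul_smul]

variable {V} in
theorem indDelta_indMk (s : S) (x : θ.CrossedProduct) (v : V) :
    θ.indDelta V s (θ.indMk V x v) = θ.indMk V (θ.delta s * x) (MonoidAlgebra.of K S s • v) := rfl

theorem indDelta_mul_indIncl (s : S) (a : A) :
    θ.indDelta V s * θ.indIncl V a = θ.indIncl V (θ.act s a) * θ.indDelta V s :=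
  θ.ind_hom_ext fun x v => by
    simp only [Module.End.mul_apply, indIncl_indMk, indDelta_indMk, ← mul_assoc, delta_mul_incl]

theorem indIncl_mul_indDelta_of_natLE {s t : S} (hst : NatLE s t) {a : A} (ha : θ.unit s * a = a) :
    θ.indIncl V a * θ.indDelta V s = θ.indIncl V a * θ.indDelta V t := by
  obtain ⟨e, he, rfl⟩ := hst
  have h_unit : a * θ.unit e = a := by
    rw [← unit_central, ← ha, unit_idem_mul θ he, ← mul_assoc, ← mul_assoc, θ.unit_idem]
  have h_absorb : θ.incl a * θ.delta e = θ.incl a := by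
    rw [delta_of_idem θ he, ← _root_.map_mul, h_unit]
  refine θ.ind_hom_ext fun x v => ?_
  simp only [Module.End.mul_apply, indIncl_indMk, indDelta_indMk]
  calc θ.indMk V (θ.incl a * (θ.delta (e * t) * x)) (MonoidAlgebra.of K S (e * t) • v)
      = θ.indMk V (θ.incl a * (θ.delta t * x)) (MonoidAlgebra.of K S (e * t) • v) := by
        rw [_root_.map_mul θ.delta, mul_assoc, ← mul_assoc (θ.incl a), h_absorb]
    _ = θ.indMk V (θ.delta e * (θ.incl a * (θ.delta t * x))) (MonoidAlgebra.of K S t • v) := by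
        rw [_root_.map_mul (MonoidAlgebra.of K S), mul_smul, indMk_delta_mul θ he]
    _ = θ.indMk V (θ.incl a * (θ.delta t * x)) (MonoidAlgebra.of K S t • v) := by
        rw [← mul_assoc, ← incl_mul_delta_of_idem θ he, h_absorb]

/-- The left action of the crossed product on the induced bimodule. -/
noncomputable def indLeft : θ.CrossedProduct →ₐ[K] Module.End K (θ.Ind V) :=
  liftCrossedProduct θ (θ.indIncl V) (θ.indDelta V) (θ.indDelta_mul_indIncl V)
    (fun _ _ _ hst ha => θ.indIncl_mul_indDelta_of_natLE V hst ha)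

/-- The right action of the crossed product on the induced bimodule, `(x ⊗ v) y = x y ⊗ v`. -/
noncomputable def indRight : θ.CrossedProductᵐᵒᵖ →ₐ[K] Module.End K (θ.Ind V) :=
  AlgHom.ofLinearMap
    { toFun y := θ.indEnd (LinearMap.mulRight K y.unop) LinearMap.id (fun e he x v => by
        rw [LinearMap.mulRight_apply, LinearMap.mulRight_apply, mul_assoc, indMk_delta_mul θ he,
          LinearMap.id_apply, LinearMap.id_apply])
      map_add' y z := θ.ind_hom_ext fun x v => by
        change θ.indMk V (x * (y.unop + z.unop)) v =
          θ.indMk V (x * y.unop) v + θ.indMk V (x * z.unop) v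
        rw [mul_add, _root_.map_add, LinearMap.add_apply]
      map_smul' r y := θ.ind_hom_ext fun x v => by
        simp only [LinearMap.smul_apply, indEnd_indMk, LinearMap.mulRight_apply, unop_smul,
          _root_.map_smul, mul_smul_comm, RingHom.id_apply] }
    (θ.ind_hom_ext fun x v => by
      change θ.indMk V (x * 1) v = θ.indMk V x v
      rw [mul_one])
    (fun y z => θ.ind_hom_ext fun x v => by
      change θ.indMk V (x * (z.unop * y.unop)) v = θ.indMk V (x * z.unop * y.unop) v
      rw [mul_assoc])

variable {V} in
theorem indRight_indMk (y : θ.CrossedProductᵐᵒᵖ) (x : θ.CrossedProduct) (v : V) :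
    θ.indRight V y (θ.indMk V x v) = θ.indMk V (x * y.unop) v := rfl

theorem commute_indLeft_indRight (x : θ.CrossedProduct) (y : θ.CrossedProductᵐᵒᵖ) :
    Commute (θ.indLeft V x) (θ.indRight V y) := by
  have h_incl (a : A) : Commute (θ.indIncl V a) (θ.indRight V y) := θ.ind_hom_ext fun x v => by
    simp only [Module.End.mul_apply, indIncl_indMk, indRight_indMk, mul_assoc]
  have h_delta (s : S) : Commute (θ.indDelta V s) (θ.indRight V y) := θ.ind_hom_ext fun x v => by
    simp only [Module.End.mul_apply, indDelta_indMk, indRight_indMk, mul_assoc]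
  induction x using θ.crossedProduct_induction with
  | zero => rw [_root_.map_zero]; exact Commute.zero_left _
  | add x x' hx hx' => rw [_root_.map_add]; exact hx.add_left hx'
  | incl_mul_delta a s =>
    rw [_root_.map_mul, indLeft, liftCrossedProduct_incl, liftCrossedProduct_delta]
    exact (h_incl a).mul_left ((h_incl _).mul_left (h_delta s))

noncomputable instance : Module (Envelope K θ.CrossedProduct) (θ.Ind V) :=
  Module.compHom _ (Algebra.TensorProduct.lift (θ.indLeft V) (θ.indRight V)
    (θ.commute_indLeft_indRight V)).toRingHom

variable {V}

theorem lact_eq_indLeft (x : θ.CrossedProduct) (m : θ.Ind V) :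
    lact K x m = θ.indLeft V x m := by
  change Algebra.TensorProduct.lift (θ.indLeft V) (θ.indRight V)
    (θ.commute_indLeft_indRight V) (x ⊗ₜ[K] 1) m = _
  rw [Algebra.TensorProduct.lift_tmul, _root_.map_one, mul_one]

theorem lact_incl_indMk (a : A) (x : θ.CrossedProduct) (v : V) :
    lact K (θ.incl a) (θ.indMk V x v) = θ.indMk V (θ.incl a * x) v := by
  rw [lact_eq_indLeft, indLeft, liftCrossedProduct_incl, indIncl_indMk]

theorem lact_delta_indMk (s : S) (x : θ.CrossedProduct) (v : V) :
    lact K (θ.delta s) (θ.indMk V x v) =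
      θ.indMk V (θ.delta s * x) (MonoidAlgebra.of K S s • v) := by
  rw [lact_eq_indLeft, indLeft, liftCrossedProduct_delta, Module.End.mul_apply, indDelta_indMk,
    indIncl_indMk, ← mul_assoc, incl_unit_mul_delta]

theorem ract_indMk (x y : θ.CrossedProduct) (v : V) :
    ract K (θ.indMk V x v) y = θ.indMk V (x * y) v := by
  change Algebra.TensorProduct.lift (θ.indLeft V) (θ.indRight V)
    (θ.commute_indLeft_indRight V) (1 ⊗ₜ op y) _ = _
  rw [Algebra.TensorProduct.lift_tmul, _root_.map_one, one_mul, indRight_indMk, unop_op]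

end IndModule

/-! ### Induction is left adjoint to `T₁` -/

section Adjunction

/-- The induced bimodule as an object of the category of `Λᵉ`-modules. -/
noncomputable def indObj (V : ModuleCat.{u} (MonoidAlgebra K S)) :
    ModuleCat.{u} (Envelope K θ.CrossedProduct) :=
  ModuleCat.of _ (θ.Ind V)

variable {V : ModuleCat.{u} (MonoidAlgebra K S)} {M : ModuleCat.{u} (Envelope K θ.CrossedProduct)}

theorem indObj_hom_ext {g g' : θ.indObj V ⟶ M}
    (h : ∀ v, g.hom (θ.indMk V 1 v) = g'.hom (θ.indMk V 1 v)) : g = g' := by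
  ext (m : θ.Ind V)
  induction m using θ.ind_induction with
  | mk x v =>
    have h_mk : θ.indMk V x v = ract K (θ.indMk V 1 v) x := by rw [ract_indMk, one_mul]
    rw [h_mk]
    exact (hom_ract g x _).trans ((congrArg (ract K · x) (h v)).trans (hom_ract g' x _).symm)
  | add m n hm hn =>
    exact (g.hom.map_add m n).trans ((congrArg₂ _ hm hn).trans (g'.hom.map_add m n).symm)

theorem indMk_one_smul (r : K) (v : V) :
    θ.indMk V 1 (r • v) = ract K (θ.indMk V 1 v) (algebraMap K θ.CrossedProduct r) := by
  rw [ract_indMk, one_mul, Algebra.algebraMap_eq_smul_one, LinearMap.map_smul, LinearMap.map_smul,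
    LinearMap.smul_apply]

theorem indMk_one_of_smul (s : S) (v : V) : θ.indMk V 1 (MonoidAlgebra.of K S s • v) =
    lact K (θ.delta s) (ract K (θ.indMk V 1 v) (θ.delta s⁻¹)) := by
  rw [ract_indMk, one_mul, lact_delta_indMk, ← _root_.map_mul θ.delta, ← mul_one (θ.delta _),
    indMk_delta_mul θ (mul_inv_idem s), ← mul_smul, ← _root_.map_mul (MonoidAlgebra.of K S),
    mul_inv_mul]

variable (V) in
/-- The homomorphism `v ↦ 1 ⊗ v`, the unit of the adjunction between induction and `T₁`. -/
noncomputable def indUnit : V ⟶ θ.T1.obj (θ.indObj V) :=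
  θ.t1HomMk (M := θ.indObj V) (θ.indMk V 1).toAddMonoidHom
    (fun a v => (θ.lact_incl_indMk a 1 v).trans
      (((θ.ract_indMk 1 (θ.incl a) v).trans (by rw [one_mul, mul_one])).symm))
    (fun r v => by
      let w : θ.indObj V := θ.indMk V 1 v
      have hw : ract K w (algebraMap K θ.CrossedProduct r) = r • w := ract_algebraMap K r w
      exact (θ.indMk_one_smul r v).trans hw)
    θ.indMk_one_of_smul

theorem evalOne_indUnit (v : V) :
    θ.evalOne (θ.indObj V) ((θ.indUnit V).hom v) = θ.indMk V 1 v :=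
  θ.evalOne_t1HomMk _ _ _ _ v

theorem evalOne_of_smul_of_idem {e : S} (he : e * e = e) (f : θ.T1.obj M) :
    θ.evalOne M (MonoidAlgebra.of K S e • f) = ract K (θ.evalOne M f) (θ.delta e) := by
  rw [evalOne_of_smul, inv_of_idem he, ← ract_lact, delta_of_idem θ he, lact_incl_evalOne,
    ← ract_mul, ← _root_.map_mul, θ.unit_idem]

theorem ract_delta_evalOne_of_smul (s : S) (f : θ.T1.obj M) :
    ract K (θ.evalOne M (MonoidAlgebra.of K S s • f)) (θ.delta s) =
      lact K (θ.delta s) (θ.evalOne M f) := by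
  have h_range : ract K (θ.evalOne M f) (θ.delta (s⁻¹ * s)) =
      lact K (θ.delta (s⁻¹ * s)) (θ.evalOne M f) := by
    rw [delta_of_idem θ (inv_mul_idem s), lact_incl_evalOne]
  rw [evalOne_of_smul, ract_lact, ← ract_mul, ← _root_.map_mul, h_range, ← mul_lact,
    ← _root_.map_mul, ← mul_assoc, mul_inv_mul]

variable (φ : V ⟶ θ.T1.obj M)

theorem evalOne_hom_smul (r : K) (v : V) :
    θ.evalOne M (φ.hom (r • v)) = r • θ.evalOne M (φ.hom v) :=
  (congrArg (θ.evalOne M) (φ.hom.map_smul _ v)).trans (θ.evalOne_algebraMap_smul r _)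

/-- The linear map underlying `indDesc`. -/
noncomputable def indDescLinear : θ.Ind V →ₗ[K] M :=
  θ.indLift (LinearMap.mk₂ K (fun x v => ract K (θ.evalOne M (φ.hom v)) x)
    (fun _ _ _ => ract_add K _ _ _) (fun _ _ _ => ract_smul K _ _ _)
    (fun x v w => by rw [_root_.map_add, _root_.map_add, add_ract])
    (fun r x v => by rw [evalOne_hom_smul, smul_ract])) (fun e he x v => by
    rw [LinearMap.mk₂_apply, LinearMap.mk₂_apply, _root_.map_smul, evalOne_of_smul_of_idem θ he,
      ract_mul])

theorem indDescLinear_indMk (x : θ.CrossedProduct) (v : V) :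
    θ.indDescLinear φ (θ.indMk V x v) = ract K (θ.evalOne M (φ.hom v)) x := rfl

theorem indDescLinear_lact (x : θ.CrossedProduct) (m : θ.Ind V) :
    θ.indDescLinear φ (lact K x m) = lact K x (θ.indDescLinear φ m) := by
  induction m using θ.ind_induction with
  | add m n hm hn => rw [lact_add, _root_.map_add, hm, hn, _root_.map_add, lact_add]
  | mk y v =>
    induction x using θ.crossedProduct_induction with
    | zero => rw [zero_lact, zero_lact, _root_.map_zero]
    | add x x' hx hx' => rw [add_lact, add_lact, _root_.map_add, hx, hx']
    | incl_mul_delta a s =>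
      rw [mul_lact, lact_delta_indMk, lact_incl_indMk, indDescLinear_indMk, indDescLinear_indMk,
        _root_.map_smul, ract_mul, ract_mul, ← lact_incl_evalOne, ract_lact,
        ract_delta_evalOne_of_smul, ract_lact, ract_lact, mul_lact]

theorem indDescLinear_ract (x : θ.CrossedProduct) (m : θ.Ind V) :
    θ.indDescLinear φ (ract K m x) = ract K (θ.indDescLinear φ m) x := by
  induction m using θ.ind_induction with
  | mk y v => rw [ract_indMk, indDescLinear_indMk, indDescLinear_indMk, ract_mul]
  | add m n hm hn => rw [add_ract, _root_.map_add, hm, hn, _root_.map_add, add_ract]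

/-- The homomorphism `x ⊗ v ↦ φ(v)(1) x` of bimodules corresponding to `φ : V ⟶ T₁ M`. -/
noncomputable def indDesc : θ.indObj V ⟶ M :=
  ModuleCat.ofHom (Y := M)
    { toFun := θ.indDescLinear φ
      map_add' := (θ.indDescLinear φ).map_add
      map_smul' := map_smul_of_map_lact_of_map_ract (θ.indDescLinear φ).toAddMonoidHom
        (θ.indDescLinear_lact φ) (θ.indDescLinear_ract φ) }

theorem indDesc_indMk (x : θ.CrossedProduct) (v : V) :
    (θ.indDesc φ).hom (θ.indMk V x v) = ract K (θ.evalOne M (φ.hom v)) x := rfl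

variable (V M) in
/-- The bimodule homomorphisms from the induced bimodule of `V` to `M` are the `KS`-homomorphisms
from `V` to `T₁ M`. -/
noncomputable def indHomEquiv : (θ.indObj V ⟶ M) ≃ (V ⟶ θ.T1.obj M) where
  toFun g := θ.indUnit V ≫ θ.T1.map g
  invFun φ := θ.indDesc φ
  left_inv g := θ.indObj_hom_ext fun v => by
    rw [indDesc_indMk, ract_one, ModuleCat.comp_apply, evalOne_t1_map, evalOne_indUnit]
  right_inv φ := by
    ext v
    refine θ.evalOne_injective ?_
    rw [ModuleCat.comp_apply, evalOne_t1_map, evalOne_indUnit, indDesc_indMk, ract_one]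

/-- Induction of `KS`-modules to bimodules over the crossed product. -/
noncomputable def indFunctor :
    ModuleCat.{u} (MonoidAlgebra K S) ⥤ ModuleCat.{u} (Envelope K θ.CrossedProduct) :=
  Adjunction.leftAdjointOfEquiv (G := θ.T1) θ.indHomEquiv fun V _ _ g h =>
    (congrArg (θ.indUnit V ≫ ·) (θ.T1.map_comp h g)).trans (Category.assoc _ _ _).symm

/-- Induction is left adjoint to `T₁`. -/
noncomputable def indAdjunction : θ.indFunctor ⊣ θ.T1 :=
  Adjunction.adjunctionOfEquivLeft _ _

theorem indFunctor_map_indMk {V W : ModuleCat.{u} (MonoidAlgebra K S)} (f : V ⟶ W)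
    (x : θ.CrossedProduct) (v : V) :
    (θ.indFunctor.map f).hom (θ.indMk V x v) = θ.indMk W x (f.hom v) := by
  have h_one : θ.evalOne (θ.indObj W) ((f ≫ θ.indHomEquiv W _ (𝟙 _)).hom v) =
      θ.indMk W 1 (f.hom v) := θ.evalOne_indUnit (f.hom v)
  refine (congrArg (ract K · x) h_one).trans ((θ.ract_indMk 1 x (f.hom v)).trans ?_)
  rw [one_mul]

section Flat

attribute [local instance] moduleIdemCrossedProduct moduleIdem

theorem flat_crossedProduct : Module.Flat (MonoidAlgebra K (idemSubmonoid S)) θ.CrossedProduct :=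
  flat_of_forall_exists_mul_mul_eq_self (monoidAlgebra_exists_mul_mul_eq_self
    (fun k => ⟨k⁻¹, mul_inv_mul_cancel k⟩) fun e => Subtype.ext e.2) _

theorem indFunctor_map_injective {V W : ModuleCat.{u} (MonoidAlgebra K S)} {f : V ⟶ W}
    (hf : Function.Injective f.hom) : Function.Injective (θ.indFunctor.map f).hom := by
  have := θ.flat_crossedProduct
  let f' : V →ₗ[MonoidAlgebra K (idemSubmonoid S)] W :=
    { toFun := f.hom
      map_add' := f.hom.map_add
      map_smul' r v := f.hom.map_smul (idemAlgHom K S r) v }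
  have h_map (m : θ.Ind V) :
      (θ.indFunctor.map f).hom m = LinearMap.lTensor θ.CrossedProduct f' m := by
    induction m using θ.ind_induction with
    | mk x v => exact θ.indFunctor_map_indMk f x v
    | add m n hm hn =>
      exact (_root_.map_add _ m n).trans
        ((congrArg₂ _ hm hn).trans (_root_.map_add _ m n).symm)
  have h_lTensor := Module.Flat.lTensor_preserves_injective_linearMap (M := θ.CrossedProduct) f' hf
  exact fun m n hmn => h_lTensor ((h_map m).symm.trans (hmn.trans (h_map n)))

end Flat

instance : θ.indFunctor.PreservesMonomorphisms where
  preserves f hf := (ModuleCat.mono_iff_injective _).2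
    (θ.indFunctor_map_injective ((ModuleCat.mono_iff_injective f).1 hf))

instance : θ.T1.PreservesInjectiveObjects :=
  Functor.preservesInjectiveObjects_of_adjunction_of_preservesMonomorphisms θ.indAdjunction

end Adjunction

end UnitalAction

theorem mainTheorem2 {K S A : Type u} [Field K] [InverseMonoid S] [Ring A] [Algebra K A]
    (θ : UnitalAction K S A) (M : ModuleCat.{u} (Envelope K θ.CrossedProduct)) :
    ∃ E : E₂CohomologicalSpectralSequenceNat (ModuleCat.{u} K),
      (∀ p q : ℕ, Nonempty ((E.page 2).X (p, q) ≅
        InverseMonoid.cohomology ((θ.T1.rightDerived q).obj M) p)) ∧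
      ConvergesTo E (hochschildCohomology M) :=
  exists_grothendieck_spectralSequence θ.T1 (regularBimodule K θ.CrossedProduct)
    (InverseMonoid.trivialModule K S) θ.trivialModuleHomEquivRegular
    θ.trivialModuleHomEquivRegular_comp M
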